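/- Let $\mathbb P$ be the class of triples $(P,\le,\delta)$ where $(P,\le)$ is a countable partial order in which every element has only finitely many elements below it, and $\delta:P\to\omega\setminus\{0,1\}$. For $(P,\le,\delta)\in\mathbb P$ let $\mathcal L_P=\{E_p:p\in P\}$ be the language with one binary relation symbol for each $p\in P$, and let $T_P$ be the first-order theory asserting: * each $E_p$ is an equivalence relation; * if $q'\le q$ then $E_q$ refines $E_{q'}$, and, writing $E_{<q}(x,y)$ for $\bigwedge_{q'<q}E_{q'}(x,y)$, $E_q$ partitions each $E_{<q}$-class into precisely $\delta(q)$ classes; * if $Q\subseteq P$ is finite and downward closed, then for every $(a_q:q\in Q)$ with $E_{q'}(a_{q'},a_q)$ for all $q'\le q$ in $Q$, there is $a^*$ with $E_q(a^*,a_q)$ for all $q\in Q$. Let $\Phi_P$ be the sentence of $\mathcal L_{\omega_1\omega}$ asserting $T_P$ together with: for all $a,b$, if $E_p(a,b)$ for all $p\in P$, then $a=b$. For a sentence $\Phi$ of $\mathcal L_{\omega_1\omega}$, let $\mathcal C(\Phi)$ be the sentence, in the language expanded by unary predicates for the colors $k<\omega$, asserting $\Phi$ and that every element has exactly one color. Let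 $\mathrm{Mod}(\Phi)$ be the space of models of $\Phi$ with universe $\omega$, and write $\Phi\le_B\Psi$ if there is a Borel map $f:\mathrm{Mod}(\Phi)\to\mathrm{Mod}(\Psi)$ such that for all $M,N\in\mathrm{Mod}(\Phi)$, $M\cong N$ if and only if $f(M)\cong f(N)$. Say that $(P,\le,\delta)$ is *nearly binary crosscutting* if all but finitely many $p\in P$ are maximal and have $\delta(p)=2$. Define $(P_i,\le,\delta_i)\in\mathbb P$ for $i<4$ as follows: * $P_0$ is an $\omega$-chain and $\delta_0$ is identically $2$; * $P_1$ is a countably infinite antichain and $\delta_1$ is identically $3$; * $P_2=\{p_n,q_n:n<\omega\}$ (all distinct), whose only strict relations are $p_n<q_n$ for each $n$, and $\delta_2$ is identically $2$; * $P_3=\{p_n,q_n:n<\omega\}$ (all distinct), whose only strict relations are $p_n<q_m$ for $n\le m$, and $\delta_3$ is identically $2$. **Theorem.** Suppose $(P,\le,\delta)\in\mathbb P$ is not nearly binary crosscutting. Then there is $i<4$ such that $\mathcal C(\Phi_{P_i})\le_B\mathcal C(\Phi_P)$. -/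

import Mathlib

universe u v w x y u' v'

namespace BorelComplexity

/-! ### The infinitary logic `L_{ω₁ω}` -/

/-- Formulas of `L_{ω₁ω}` over the language `L`, with free variables indexed by `α` and by
`Fin n`: Mathlib's first-order `L.BoundedFormula α n` together with countable conjunctions. -/
inductive InfFormula (L : FirstOrder.Language.{u, v}) (α : Type w) : ℕ → Type (max u v w)
  | falsum {n} : InfFormula L α n
  | equal {n} (t₁ t₂ : L.Term (α ⊕ Fin n)) : InfFormula L α n
  | rel {n l : ℕ} (R : L.Relations l) (ts : Fin l → L.Term (α ⊕ Fin n)) : InfFormula L α n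
  | imp {n} (φ ψ : InfFormula L α n) : InfFormula L α n
  | all {n} (φ : InfFormula L α (n + 1)) : InfFormula L α n
  | conj {n} (φ : ℕ → InfFormula L α n) : InfFormula L α n

/-- Sentences of `L_{ω₁ω}`. -/
abbrev InfSentence (L : FirstOrder.Language.{u, v}) := InfFormula L Empty 0

namespace InfFormula

variable {L : FirstOrder.Language.{u, v}} {L' : FirstOrder.Language.{u', v'}} {α : Type w} {n : ℕ}

/-- Satisfaction of a formula of `L_{ω₁ω}`. -/
def Realize {M : Type x} [L.Structure M] :
    ∀ {n : ℕ}, InfFormula L α n → (α → M) → (Fin n → M) → Prop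
  | _, falsum, _, _ => False
  | _, equal t₁ t₂, a, xs => t₁.realize (Sum.elim a xs) = t₂.realize (Sum.elim a xs)
  | _, rel R ts, a, xs =>
      FirstOrder.Language.Structure.RelMap R fun i => (ts i).realize (Sum.elim a xs)
  | _, imp φ ψ, a, xs => Realize φ a xs → Realize ψ a xs
  | _, all φ, a, xs => ∀ x : M, Realize φ a (Fin.snoc xs x)
  | _, conj φ, a, xs => ∀ k, Realize (φ k) a xs

protected def not (φ : InfFormula L α n) : InfFormula L α n := φ.imp falsum

/-- Conjunction of a countable family. -/
noncomputable def iInf {ι : Type x} [Countable ι] (φ : ι → InfFormula L α n) :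
    InfFormula L α n :=
  conj fun k => ((@Encodable.decode ι (Encodable.ofCountable ι) k).map φ).getD (falsum.imp falsum)

/-- Disjunction of a countable family. -/
noncomputable def iSup {ι : Type x} [Countable ι] (φ : ι → InfFormula L α n) :
    InfFormula L α n :=
  (iInf fun i => (φ i).not).not

protected noncomputable def and (φ ψ : InfFormula L α n) : InfFormula L α n :=
  iInf fun b : Bool => if b then φ else ψ

/-- First-order formulas are formulas of `L_{ω₁ω}`. -/
def ofFirstOrder : ∀ {n : ℕ}, L.BoundedFormula α n → InfFormula L α n
  | _, .falsum => falsum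
  | _, .equal t₁ t₂ => equal t₁ t₂
  | _, .rel R ts => rel R ts
  | _, .imp φ ψ => imp (ofFirstOrder φ) (ofFirstOrder ψ)
  | _, .all φ => all (ofFirstOrder φ)

/-- Translation of formulas along a morphism of languages. -/
def mapLanguage (g : FirstOrder.Language.LHom L L') : ∀ {n : ℕ}, InfFormula L α n → InfFormula L' α n
  | _, falsum => falsum
  | _, equal t₁ t₂ => equal (g.onTerm t₁) (g.onTerm t₂)
  | _, rel R ts => rel (g.onRelation R) fun i => g.onTerm (ts i)
  | _, imp φ ψ => imp (mapLanguage g φ) (mapLanguage g ψ)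
  | _, all φ => all (mapLanguage g φ)
  | _, conj φ => conj fun k => mapLanguage g (φ k)

theorem realize_iInf {M : Type y} [L.Structure M] {ι : Type x} [Countable ι]
    (φ : ι → InfFormula L α n) (a : α → M) (xs : Fin n → M) :
    (iInf φ).Realize a xs ↔ ∀ i, (φ i).Realize a xs := by
  constructor
  · intro h i
    have := h (@Encodable.encode ι (Encodable.ofCountable ι) i)
    simpa [Encodable.encodek] using this
  · intro h k
    change ((Option.map φ (@Encodable.decode ι (Encodable.ofCountable ι) k)).getD
      (falsum.imp falsum)).Realize a xs
    rcases @Encodable.decode ι (Encodable.ofCountable ι) k with _ | i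
    · exact id
    · exact h i

end InfFormula

/-! ### The space of models with universe `ω` and Borel reducibility -/

/-- The topology on the `L`-structures with universe `ℕ`: the coarsest one for which every
evaluation `M ↦ f^M(v)` and `M ↦ R^M(v)` is continuous into a discrete space. -/
instance structureTopology (L : FirstOrder.Language.{u, v}) : TopologicalSpace (L.Structure ℕ) :=
  (⨅ (n : ℕ) (f : L.Functions n) (v : Fin n → ℕ),
    TopologicalSpace.induced (fun M : L.Structure ℕ => M.funMap f v) ⊥) ⊓
  (⨅ (n : ℕ) (R : L.Relations n) (v : Fin n → ℕ),
    TopologicalSpace.induced (fun M : L.Structure ℕ => M.RelMap R v) ⊥)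

/-- `Mod(Φ)`: the models of `Φ` with universe `ℕ`, with the subspace topology. -/
abbrev Mod {L : FirstOrder.Language.{u, v}} (Φ : InfSentence L) : Type (max u v) :=
  {M : L.Structure ℕ // @InfFormula.Realize L Empty ℕ M 0 Φ default default}

instance modMeasurableSpace {L : FirstOrder.Language.{u, v}} (Φ : InfSentence L) :
    MeasurableSpace (Mod Φ) := borel (Mod Φ)

/-- Isomorphism of structures with universe `ℕ`. -/
def Iso {L : FirstOrder.Language.{u, v}} (M N : L.Structure ℕ) : Prop :=
  Nonempty (@FirstOrder.Language.Equiv L ℕ ℕ M N)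

/-- Borel reducibility `Φ ≤_B Ψ`. -/
def BorelReducible {L : FirstOrder.Language.{u, v}} {L' : FirstOrder.Language.{u', v'}}
    (Φ : InfSentence L) (Ψ : InfSentence L') : Prop :=
  ∃ f : Mod Φ → Mod Ψ, Measurable f ∧
    ∀ M N : Mod Φ, Iso M.1 N.1 ↔ Iso (f M).1 (f N).1

/-! ### Colorings -/

inductive ColorRel : ℕ → Type
  | color (k : ℕ) : ColorRel 1

/-- The language with a unary predicate for each color `k : ℕ`. -/
def colorLanguage : FirstOrder.Language.{0, 0} := ⟨fun _ => Empty, ColorRel⟩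

/-- The atomic formula "the last bound variable has color `k`". -/
def hasColor (L : FirstOrder.Language.{u, v}) (k : ℕ) : InfFormula (L.sum colorLanguage) Empty 1 :=
  .rel (l := 1) (Sum.inr (ColorRel.color k)) fun _ => FirstOrder.Language.Term.var (Sum.inr 0)

/-- `𝓒(Φ)`: the sentence describing the `ω`-colorings of models of `Φ`. A model is a model of `Φ`
together with unary color predicates such that each element has exactly one color. -/
noncomputable def colorings {L : FirstOrder.Language.{u, v}} (Φ : InfSentence L) :
    InfSentence (L.sum colorLanguage) :=
  (Φ.mapLanguage FirstOrder.Language.LHom.sumInl).and <|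
    InfFormula.all <|
      (InfFormula.iSup fun k : ℕ => hasColor L k).and <|
        InfFormula.iInf fun kl : {kl : ℕ × ℕ // kl.1 ≠ kl.2} =>
          ((hasColor L kl.1.1).and (hasColor L kl.1.2)).not

/-! ### The class `ℙ` and the theories `T_P` -/

/-- The class `ℙ` of triples `(P, ≤, δ)`: a countable partial order in which every element has
only finitely many elements below it, and a function `δ : P → ω \ {0, 1}`. -/
structure SplittingPoset : Type (u + 1) where
  carrier : Type u
  [order : PartialOrder carrier]
  countable : Countable carrier
  finite_Iic : ∀ p : carrier, (Set.Iic p).Finite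
  δ : carrier → ℕ
  two_le_δ : ∀ p, 2 ≤ δ p

attribute [instance] SplittingPoset.order SplittingPoset.countable

namespace SplittingPoset

/-- All but finitely many `p ∈ P` are maximal and satisfy `δ p = 2`. -/
def NearlyBinaryCrosscutting (P : SplittingPoset.{u}) : Prop :=
  {p : P.carrier | ¬ (IsMax p ∧ P.δ p = 2)}.Finite

inductive Rel (P : Type u) : ℕ → Type u
  | E (p : P) : Rel P 2

/-- The language `𝓛_P` with one binary relation symbol `E_p` for each `p ∈ P`. -/
def language (P : SplittingPoset.{u}) : FirstOrder.Language.{0, u} := ⟨fun _ => Empty, Rel P.carrier⟩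

variable (P : SplittingPoset.{u})

def symb (p : P.carrier) : P.language.Relations 2 := Rel.E p

/-- The formula `E_p(x, y)`. -/
def E {α : Type w} (p : P.carrier) (x y : α) : P.language.Formula α :=
  (P.symb p).formula₂ (FirstOrder.Language.Term.var x) (FirstOrder.Language.Term.var y)

instance finite_below (q : P.carrier) : Finite {r : P.carrier // r < q} :=
  ((P.finite_Iic q).subset fun _ hr => le_of_lt hr).to_subtype

/-- The formula `E_{<q}(x, y)`, the conjunction of all `E_r(x, y)` with `r < q`. -/
noncomputable def Elt {α : Type w} (q : P.carrier) (x y : α) : P.language.Formula α :=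
  FirstOrder.Language.Formula.iInf fun r : {r : P.carrier // r < q} => P.E r.1 x y

/-- If `r ≤ q` then `E_q` refines `E_r`. -/
noncomputable def refineAxiom (rq : {rq : P.carrier × P.carrier // rq.1 ≤ rq.2}) :
    P.language.Sentence :=
  FirstOrder.Language.Formula.iAlls (α := Empty) (Fin 2) <|
    (P.E rq.1.2 (Sum.inr 0) (Sum.inr 1)).imp (P.E rq.1.1 (Sum.inr 0) (Sum.inr 1))

/-- `E_q` partitions each `E_{<q}`-class into precisely `δ q` classes: for every `x` there are
`y_i` (`i < δ q`) in the `E_{<q}`-class of `x`, pairwise not `E_q`-related, such that every `z` in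
that class is `E_q`-related to some `y_i`. -/
noncomputable def splitAxiom (q : P.carrier) : P.language.Sentence :=
  FirstOrder.Language.Formula.iAlls (α := Empty) (Fin 1) <|
    FirstOrder.Language.Formula.iExs (Fin (P.δ q)) <|
      (FirstOrder.Language.Formula.iInf fun i : Fin (P.δ q) =>
        P.Elt q (Sum.inl (Sum.inr 0)) (Sum.inr i)) ⊓
      (FirstOrder.Language.Formula.iInf fun ij : {ij : Fin (P.δ q) × Fin (P.δ q) // ij.1 ≠ ij.2} =>
        (P.E q (Sum.inr ij.1.1) (Sum.inr ij.1.2)).not) ⊓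
      FirstOrder.Language.Formula.iAlls (Fin 1)
        ((P.Elt q (Sum.inl (Sum.inl (Sum.inr 0))) (Sum.inr 0)).imp <|
          FirstOrder.Language.Formula.iSup fun i : Fin (P.δ q) =>
            P.E q (Sum.inl (Sum.inr i)) (Sum.inr 0))

/-- For `Q ⊆ P` finite and downward closed: for every `(a_q : q ∈ Q)` with `E_r(a_r, a_q)` for all
`r ≤ q` in `Q`, there is `a*` with `E_q(a*, a_q)` for every `q ∈ Q`. -/
noncomputable def amalgamAxiom
    (Q : {Q : Finset P.carrier // IsLowerSet (Q : Set P.carrier)}) : P.language.Sentence :=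
  FirstOrder.Language.Formula.iAlls (α := Empty) {q // q ∈ Q.1} <|
    (FirstOrder.Language.Formula.iInf fun rq : {rq : {q // q ∈ Q.1} × {q // q ∈ Q.1} // rq.1 ≤ rq.2} =>
      P.E rq.1.1.1 (Sum.inr rq.1.1) (Sum.inr rq.1.2)).imp <|
    FirstOrder.Language.Formula.iExs (Fin 1) <|
      FirstOrder.Language.Formula.iInf fun q : {q // q ∈ Q.1} =>
        P.E q.1 (Sum.inr 0) (Sum.inl (Sum.inr q))

/-- The first-order theory `T_P`. -/
noncomputable def theory : P.language.Theory :=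
  Set.range (fun q => (P.symb q).reflexive) ∪
  Set.range (fun q => (P.symb q).symmetric) ∪
  Set.range (fun q => (P.symb q).transitive) ∪
  Set.range P.refineAxiom ∪ Set.range P.splitAxiom ∪ Set.range P.amalgamAxiom

instance countable_theory : Countable P.theory := by
  refine Set.Countable.to_subtype ?_
  unfold theory
  simp only [Set.countable_union]
  exact ⟨⟨⟨⟨⟨Set.countable_range _, Set.countable_range _⟩, Set.countable_range _⟩,
    Set.countable_range _⟩, Set.countable_range _⟩, Set.countable_range _⟩

/-- The sentence `Φ_P` of `L_{ω₁ω}`: the axioms `T_P` together with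
"for all `a, b`, if `E_p(a, b)` for all `p ∈ P` then `a = b`". -/
noncomputable def Φ : InfSentence P.language :=
  (InfFormula.iInf fun φ : P.theory => InfFormula.ofFirstOrder φ.1).and <|
    InfFormula.all <| InfFormula.all <|
      (InfFormula.iInf fun p : P.carrier => InfFormula.ofFirstOrder (n := 2)
        ((P.symb p).boundedFormula₂ (FirstOrder.Language.Term.var (Sum.inr 0))
          (FirstOrder.Language.Term.var (Sum.inr 1)))).imp <|
      InfFormula.equal (FirstOrder.Language.Term.var (Sum.inr 0)) (FirstOrder.Language.Term.var (Sum.inr 1))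

end SplittingPoset

/-! ### The four benchmarks -/

/-- `P₀`: an `ω`-chain, with `δ` identically `2`. -/
def benchmark₀ : SplittingPoset.{0} where
  carrier := ℕ
  countable := inferInstance
  finite_Iic := Set.finite_Iic
  δ := fun _ => 2
  two_le_δ := fun _ => le_rfl

/-- `P₁`: an infinite antichain, with `δ` identically `3`. -/
def benchmark₁ : SplittingPoset.{0} where
  carrier := ℕ
  order :=
    { le := fun a b => a = b
      lt := fun _ _ => False
      lt_iff_le_not_ge := fun _ _ => ⟨False.elim, fun h => h.2 h.1.symm⟩
      le_refl := fun _ => rfl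
      le_trans := fun _ _ _ h h' => h.trans h'
      le_antisymm := fun _ _ h _ => h }
  countable := inferInstance
  finite_Iic := fun p => Set.finite_singleton p
  δ := fun _ => 3
  two_le_δ := fun _ => by norm_num

/-- The set `{p_n, q_n : n < ω}`. -/
inductive PQ : Type
  | p (n : ℕ)
  | q (n : ℕ)

theorem PQ.countable : Countable PQ := by
  have : Function.Surjective (Sum.elim PQ.p PQ.q) := by
    rintro (n | n)
    · exact ⟨Sum.inl n, rfl⟩
    · exact ⟨Sum.inr n, rfl⟩
  exact this.countable

/-- The partial order on `{p_n, q_n : n < ω}` whose only strict relations are `p_n < q_m` with `r n m`. -/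
@[reducible]
def PQ.order (r : ℕ → ℕ → Prop) : PartialOrder PQ where
  le a b := a = b ∨ ∃ n m, r n m ∧ a = PQ.p n ∧ b = PQ.q m
  le_refl _ := Or.inl rfl
  le_trans := by
    rintro a b c (rfl | ⟨n, m, h, rfl, rfl⟩) (rfl | ⟨n', m', h', h1, h2⟩)
    · exact Or.inl rfl
    · exact Or.inr ⟨n', m', h', h1, h2⟩
    · exact Or.inr ⟨n, m, h, rfl, rfl⟩
    · cases h1
  le_antisymm := by
    rintro a b (rfl | ⟨n, m, h, rfl, rfl⟩) (h' | ⟨n', m', h', h1, h2⟩)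
    · rfl
    · rfl
    · exact h'.symm
    · cases h1

theorem PQ.finite_Iic (r : ℕ → ℕ → Prop) (hr : ∀ n m, r n m → n ≤ m) (b : PQ) :
    (@Set.Iic PQ (PQ.order r).toPreorder b).Finite := by
  obtain ⟨k, hk⟩ : ∃ k : ℕ, ∀ m, b = PQ.q m → m ≤ k := by
    cases b with
    | p m => exact ⟨0, fun _ h => by cases h⟩
    | q m => exact ⟨m, fun _ h => by cases h; exact le_rfl⟩
  refine (((Set.finite_Iic k).image PQ.p).insert b).subset ?_
  rintro a (rfl | ⟨n, m, h, rfl, h2⟩)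
  · exact Set.mem_insert _ _
  · exact Set.mem_insert_of_mem _ ⟨n, (hr n m h).trans (hk m h2), rfl⟩

/-- `P₂`: the elements `p_n, q_n` with only the relations `p_n < q_n`, and `δ` identically `2`. -/
def benchmark₂ : SplittingPoset.{0} where
  carrier := PQ
  order := PQ.order fun n m => n = m
  countable := PQ.countable
  finite_Iic := PQ.finite_Iic _ fun _ _ => Nat.le_of_eq
  δ := fun _ => 2
  two_le_δ := fun _ => le_rfl

/-- `P₃`: the elements `p_n, q_n` with only the relations `p_n < q_m` for `n ≤ m`, and `δ`
identically `2`. -/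
def benchmark₃ : SplittingPoset.{0} where
  carrier := PQ
  order := PQ.order fun n m => n ≤ m
  countable := PQ.countable
  finite_Iic := PQ.finite_Iic _ fun _ _ h => h
  δ := fun _ => 2
  two_le_δ := fun _ => le_rfl

/-- The four benchmarks `P₀, P₁, P₂, P₃`. -/
def benchmark : Fin 4 → SplittingPoset.{0} :=
  ![benchmark₀, benchmark₁, benchmark₂, benchmark₃]

end BorelComplexity

/-!
A model of `Φ_P` is, after naming the `E_q`-classes inside each `E_{<q}`-class, a dense subset of
the product of the sets `{0, …, δ p - 1}`, where `E_p(x, y)` says that `x` and `y` agree at all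
indices below `p`. The theorem follows from two facts.

*Suborders give reductions* (`SplittingPoset.Embeds.borelReducible`). Let `φ : Q → P` be an order
embedding with `δ_Q q ≤ δ_P (φ q)`; its range need not be downward closed. The product for `Q` sits
inside the product for `P` as the set of points with value `0` at each index off the range of `φ`
and value less than `δ_Q q` at `φ q`. A model `M` of `Φ_Q` is a dense subset of that small product,
and it remains to add, without using any names for classes, a countable set of points which is dense
in the complement. The added points follow a point of `M` up to the first indices at which they
leave the small product, and from there on their labels are given by a finitely supported function:
see `enlargeRel`, and `IsSplittingSystem.enlarge` for the axioms. They get a color of their own, so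
that `M` can be recovered (`systemIso_restrict_enlarge`). Different pairs of a point of `M` and a
finitely supported function may define the same added point. To obtain a model with universe `ℕ` in
a Borel way, the universe is taken to be the set of least representatives, enumerated in increasing
order (`isTransversal_leastRep`, `measurable_leastRep`).

*A poset which is not nearly binary crosscutting has a benchmark as a suborder*
(`SplittingPoset.exists_benchmark_embeds`). There are infinitely many `p` with `δ p ≥ 3` or
infinitely many nonmaximal `p`. By Ramsey's theorem, an infinite set contains an infinite chain,
which gives `P₀`, or an infinite antichain. An antichain with `δ ≥ 3` gives `P₁`. An antichain of
nonmaximal elements, together with elements above them, thins out to `P₂`, `P₃` or a chain; here it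
is used again that only finitely many elements lie below a given one.
-/

namespace BorelComplexity

open FirstOrder

/-! ### Splitting systems of equivalence relations -/

/-- A family of equivalence relations `E p` on `X`, indexed by a partial order, which satisfies
the axioms of `T_P` with the splitting numbers `b p`. The value `b p = 1` is allowed, and means
that `E p` is the intersection of the relations below it. Tuples indexed by a finite set or by
`Fin (b q)` are encoded by functions on all of `ι` or `ℕ`. -/
structure IsSplittingSystem {ι : Type u} [PartialOrder ι] (b : ι → ℕ) {X : Type v}
    (E : ι → X → X → Prop) : Prop where
  equiv : ∀ p, Equivalence (E p)
  mono : ∀ {r q}, r ≤ q → ∀ {x y}, E q x y → E r x y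
  split : ∀ q x, ∃ w : ℕ → X, (∀ i < b q, ∀ r < q, E r x (w i)) ∧
    (∀ i < b q, ∀ j < b q, i ≠ j → ¬ E q (w i) (w j)) ∧
    ∀ z, (∀ r < q, E r x z) → ∃ i < b q, E q (w i) z
  amalgam : ∀ R : Finset ι, IsLowerSet (R : Set ι) → ∀ a : ι → X,
    (∀ r ∈ R, ∀ q ∈ R, r ≤ q → E r (a r) (a q)) → ∃ z, ∀ q ∈ R, E q z (a q)

/-- Every element of `X` has exactly one color, where `C k x` says that `x` has color `k`. -/
def IsColoring {X : Type v} (C : ℕ → X → Prop) : Prop := ∀ x, ∃! k, C k x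

/-- The elements of `X` are separated by the relations `E p`. -/
def Separates {ι : Type u} {X : Type v} (E : ι → X → X → Prop) : Prop :=
  ∀ x y, (∀ p, E p x y) → x = y

/-! ### Satisfaction in `L_{ω₁ω}` -/

namespace InfFormula

variable {L : FirstOrder.Language.{u, v}} {L' : FirstOrder.Language.{u', v'}} {α : Type w}

theorem realize_ofFirstOrder {M : Type x} [L.Structure M] {n : ℕ} (φ : L.BoundedFormula α n)
    (a : α → M) (xs : Fin n → M) : (ofFirstOrder φ).Realize a xs ↔ φ.Realize a xs := by
  induction φ with
  | falsum => exact Iff.rfl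
  | equal => exact Iff.rfl
  | rel => exact Iff.rfl
  | imp _ _ h1 h2 => exact imp_congr (h1 xs) (h2 xs)
  | all _ h => exact forall_congr' fun _ => h _

theorem realize_mapLanguage {M : Type x} [L.Structure M] [L'.Structure M]
    (g : L →ᴸ L') [g.IsExpansionOn M] {n : ℕ} (φ : InfFormula L α n)
    (a : α → M) (xs : Fin n → M) : (φ.mapLanguage g).Realize a xs ↔ φ.Realize a xs := by
  induction φ with
  | falsum => exact Iff.rfl
  | equal => simp only [mapLanguage, Realize, FirstOrder.Language.LHom.realize_onTerm]
  | rel => simp only [mapLanguage, Realize, FirstOrder.Language.LHom.realize_onTerm,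
      FirstOrder.Language.LHom.map_onRelation]
  | imp _ _ h1 h2 => exact imp_congr (h1 xs) (h2 xs)
  | all _ h => exact forall_congr' fun _ => h _
  | conj _ h => exact forall_congr' fun k => h k xs

variable {M : Type x} [L.Structure M] {n : ℕ}

theorem realize_not (φ : InfFormula L α n) (a : α → M) (xs : Fin n → M) :
    φ.not.Realize a xs ↔ ¬ φ.Realize a xs := Iff.rfl

theorem realize_and (φ ψ : InfFormula L α n) (a : α → M) (xs : Fin n → M) :
    (φ.and ψ).Realize a xs ↔ φ.Realize a xs ∧ ψ.Realize a xs := by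
  unfold InfFormula.and
  rw [realize_iInf, Bool.forall_bool]
  simp [and_comm]

theorem realize_iSup {ι : Type y} [Countable ι] (φ : ι → InfFormula L α n) (a : α → M)
    (xs : Fin n → M) : (iSup φ).Realize a xs ↔ ∃ i, (φ i).Realize a xs := by
  unfold iSup
  simp [realize_not, realize_iInf]

end InfFormula

namespace SplittingPoset

variable (P : SplittingPoset.{u})

theorem realize_E {X : Type x} [P.language.Structure X] {α : Type w} (p : P.carrier) (s t : α)
    (a : α → X) : (P.E p s t).Realize a ↔
      FirstOrder.Language.Structure.RelMap (P.symb p) ![a s, a t] := by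
  unfold E
  rw [FirstOrder.Language.Formula.realize_rel₂]
  simp

theorem realize_Elt {X : Type x} [P.language.Structure X] {α : Type w} (q : P.carrier) (s t : α)
    (a : α → X) : (P.Elt q s t).Realize a ↔
      ∀ r < q, FirstOrder.Language.Structure.RelMap (P.symb r) ![a s, a t] := by
  unfold Elt
  rw [FirstOrder.Language.Formula.realize_iInf]
  simp [realize_E]

theorem realize_theory {X : Type x} [Nonempty X] [P.language.Structure X] :
    X ⊨ P.theory ↔ IsSplittingSystem P.δ
      fun p (x y : X) => FirstOrder.Language.Structure.RelMap (P.symb p) ![x, y] := by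
  classical
  simp only [theory, FirstOrder.Language.Theory.model_iff, Set.mem_union, or_imp, forall_and,
    Set.forall_mem_range, FirstOrder.Language.Relations.realize_reflexive,
    FirstOrder.Language.Relations.realize_symmetric,
    FirstOrder.Language.Relations.realize_transitive]
  have h1 : ∀ i, X ⊨ P.refineAxiom i ↔ ∀ a : Fin 2 → X,
      FirstOrder.Language.Structure.RelMap (P.symb i.1.2) ![a 0, a 1] →
      FirstOrder.Language.Structure.RelMap (P.symb i.1.1) ![a 0, a 1] := by
    intro i
    simp only [refineAxiom, FirstOrder.Language.Sentence.Realize,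
      FirstOrder.Language.Formula.realize_iAlls,
      FirstOrder.Language.Formula.realize_imp, realize_E, Sum.elim_inr]
  have h2 : ∀ q, X ⊨ P.splitAxiom q ↔ ∀ a : Fin 1 → X, ∃ w : Fin (P.δ q) → X,
      ((∀ i, ∀ r < q, FirstOrder.Language.Structure.RelMap (P.symb r) ![a 0, w i]) ∧
      (∀ ij : {ij : Fin (P.δ q) × Fin (P.δ q) // ij.1 ≠ ij.2},
        ¬ FirstOrder.Language.Structure.RelMap (P.symb q) ![w ij.1.1, w ij.1.2])) ∧
      ∀ z : Fin 1 → X, (∀ r < q, FirstOrder.Language.Structure.RelMap (P.symb r) ![a 0, z 0]) →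
        ∃ i, FirstOrder.Language.Structure.RelMap (P.symb q) ![w i, z 0] := by
    intro q
    simp only [splitAxiom, FirstOrder.Language.Sentence.Realize,
      FirstOrder.Language.Formula.realize_iAlls,
      FirstOrder.Language.Formula.realize_iExs, FirstOrder.Language.Formula.realize_inf,
      FirstOrder.Language.Formula.realize_imp, FirstOrder.Language.Formula.realize_not,
      FirstOrder.Language.Formula.realize_iInf,
      FirstOrder.Language.Formula.realize_iSup, realize_E, realize_Elt, Sum.elim_inr, Sum.elim_inl]
  have h3 : ∀ Q, X ⊨ P.amalgamAxiom Q ↔ ∀ a : {q // q ∈ Q.1} → X,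
      (∀ rq : {rq : {q // q ∈ Q.1} × {q // q ∈ Q.1} // rq.1 ≤ rq.2},
        FirstOrder.Language.Structure.RelMap (P.symb rq.1.1.1) ![a rq.1.1, a rq.1.2]) →
      ∃ z : Fin 1 → X, ∀ q, FirstOrder.Language.Structure.RelMap (P.symb q.1) ![z 0, a q] := by
    intro q
    simp only [amalgamAxiom, FirstOrder.Language.Sentence.Realize,
      FirstOrder.Language.Formula.realize_iAlls,
      FirstOrder.Language.Formula.realize_iExs,
      FirstOrder.Language.Formula.realize_imp, FirstOrder.Language.Formula.realize_iInf,
      realize_E, Sum.elim_inr, Sum.elim_inl]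
  simp only [h1, h2, h3]
  constructor
  · rintro ⟨⟨⟨⟨⟨hr, hs⟩, ht⟩, hm⟩, hd⟩, ha⟩
    refine ⟨fun p => ⟨fun x => (hr p).refl x, fun {x y} h => (hs p).symm x y h,
      fun {x y z} h h' => (ht p).trans x y z h h'⟩, fun {r q} h {x y} => ?_, fun q x => ?_,
      fun R hR a h => ?_⟩
    · simpa using hm ⟨(r, q), h⟩ ![x, y]
    · obtain ⟨w, ⟨hw1, hw2⟩, hw3⟩ := hd q fun _ => x
      refine ⟨fun i => if h : i < P.δ q then w ⟨i, h⟩ else x, fun i hi r hrq => ?_,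
        fun i hi j hj hij => ?_, fun z hz => ?_⟩
      · simpa [hi] using hw1 ⟨i, hi⟩ r hrq
      · simpa [hi, hj] using hw2 ⟨(⟨i, hi⟩, ⟨j, hj⟩), by simpa using hij⟩
      · obtain ⟨i, hi⟩ := hw3 (fun _ => z) hz
        exact ⟨i, i.2, by simpa using hi⟩
    · obtain ⟨z, hz⟩ := ha ⟨R, hR⟩ (fun q => a q) fun rq =>
        h _ rq.1.1.2 _ rq.1.2.2 rq.2
      exact ⟨z 0, fun q hq => hz ⟨q, hq⟩⟩
  · intro h
    refine ⟨⟨⟨⟨⟨fun p => ⟨(h.equiv p).refl⟩, fun p => ⟨fun _ _ => (h.equiv p).symm⟩⟩,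
      fun p => ⟨fun _ _ _ => (h.equiv p).trans⟩⟩, fun i a => h.mono i.2⟩, fun q a => ?_⟩,
      fun Q a hQ => ?_⟩
    · obtain ⟨w, h1, h2, h3⟩ := h.split q (a 0)
      refine ⟨fun i => w i, ⟨fun i => h1 i i.2, fun ij => h2 _ ij.1.1.2 _ ij.1.2.2 ?_⟩,
        fun z hz => ?_⟩
      · exact fun e => ij.2 (Fin.ext e)
      · obtain ⟨i, hi, hE⟩ := h3 (z 0) hz
        exact ⟨⟨i, hi⟩, hE⟩
    · obtain ⟨z, hz⟩ := h.amalgam Q.1 Q.2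
        (fun q => if hq : q ∈ Q.1 then a ⟨q, hq⟩ else Classical.arbitrary X) (by
          intro r hr q hq hrq
          simpa [hr, hq] using hQ ⟨(⟨r, hr⟩, ⟨q, hq⟩), hrq⟩)
      exact ⟨fun _ => z, fun q => by simpa using hz q q.2⟩

/-- The relation `E_p` of a structure in the language of colorings of models of `Φ_P`. -/
def eqRel {X : Type x} (M : (P.language.sum colorLanguage).Structure X) (p : P.carrier)
    (x y : X) : Prop :=
  M.RelMap (n := 2) (Sum.inl (P.symb p)) ![x, y]

/-- `colorRel P M k x` says that `x` has color `k` in `M`. -/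
def colorRel {X : Type x} (M : (P.language.sum colorLanguage).Structure X) (k : ℕ) (x : X) :
    Prop :=
  M.RelMap (n := 1) (Sum.inr (ColorRel.color k)) ![x]

theorem realize_Φ {X : Type x} [Nonempty X] [P.language.Structure X] :
    P.Φ.Realize (default : Empty → X) default ↔
      IsSplittingSystem P.δ
        (fun p (x y : X) => FirstOrder.Language.Structure.RelMap (P.symb p) ![x, y]) ∧
      Separates fun p (x y : X) => FirstOrder.Language.Structure.RelMap (P.symb p) ![x, y] := by
  unfold Φ
  rw [InfFormula.realize_and, InfFormula.realize_iInf, ← realize_theory,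
    FirstOrder.Language.Theory.model_iff]
  refine and_congr ?_ ?_
  · simp only [InfFormula.realize_ofFirstOrder, Subtype.forall]
    exact Iff.rfl
  · refine forall_congr' fun x => forall_congr' fun y => ?_
    refine imp_congr ?_ ?_
    · rw [InfFormula.realize_iInf]
      refine forall_congr' fun p => ?_
      rw [InfFormula.realize_ofFirstOrder, FirstOrder.Language.BoundedFormula.realize_rel₂]
      exact Iff.of_eq (by congr 1)
    · exact Iff.of_eq (by congr 1)

theorem realize_colorings {X : Type} [Nonempty X]
    (M : (P.language.sum colorLanguage).Structure X) :
    (colorings P.Φ).Realize (default : Empty → X) default ↔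
      IsSplittingSystem P.δ (P.eqRel M) ∧ Separates (P.eqRel M) ∧
        IsColoring (P.colorRel M) := by
  let _ : P.language.Structure X :=
    (FirstOrder.Language.LHom.sumInl : P.language →ᴸ P.language.sum colorLanguage).reduct X
  have hc : ∀ k x (xs : Fin 1 → X), xs = ![x] →
      ((hasColor P.language k).Realize (default : Empty → X) xs ↔ P.colorRel M k x) := by
    rintro k x _ rfl
    refine Iff.of_eq ?_
    unfold hasColor colorRel
    simp only [InfFormula.Realize]
    congr 1
    ext i
    simp [Matrix.cons_val_fin_one]
  have hs : ∀ x : X, (Fin.snoc (default : Fin 0 → X) x : Fin 1 → X) = ![x] := by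
    intro x
    ext i
    simp [Fin.snoc, Matrix.cons_val_fin_one]
  unfold colorings
  rw [InfFormula.realize_and, InfFormula.realize_mapLanguage, realize_Φ, and_assoc]
  refine and_congr Iff.rfl (and_congr Iff.rfl ?_)
  refine forall_congr' fun x => ?_
  rw [hs, InfFormula.realize_and, InfFormula.realize_iSup, InfFormula.realize_iInf]
  simp only [InfFormula.realize_not, InfFormula.realize_and, hc _ x _ rfl]
  constructor
  · rintro ⟨⟨k, hk⟩, h⟩
    refine ⟨k, hk, fun l hl => ?_⟩
    by_contra hkl
    exact h ⟨(l, k), hkl⟩ ⟨hl, hk⟩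
  · rintro ⟨k, hk, h⟩
    exact ⟨⟨k, hk⟩, fun kl hkl => kl.2 ((h _ hkl.1).trans (h _ hkl.2).symm)⟩

end SplittingPoset

/-! ### Ramsey's theorem and the benchmarks inside a poset -/

/-- A form of the infinite Ramsey theorem for pairs. The terms of the sequence can moreover be
kept outside finite sets determined by the earlier terms. -/
theorem exists_seq_homogeneous {α : Type u} {S : Set α} (hS : S.Infinite) (F : α → Set α)
    (hF : ∀ x, (F x).Finite) (R : α → α → Prop) :
    ∃ f : ℕ → α, (∀ n, f n ∈ S) ∧ (∀ m n, m < n → f n ∉ F (f m)) ∧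
      ((∀ m n, m < n → R (f m) (f n)) ∨ ∀ m n, m < n → ¬ R (f m) (f n)) := by
  classical
  -- A nonprincipal ultrafilter containing `S` decides, for each `x`, whether `R x y` holds for
  -- most `y`, and then decides which of the two answers is given for most `x`.
  have hne : (Filter.cofinite ⊓ Filter.principal S).NeBot :=
    Filter.cofinite_inf_principal_neBot_iff.2 hS
  let U : Ultrafilter α := Ultrafilter.of (Filter.cofinite ⊓ Filter.principal S)
  have hU : (U : Filter α) ≤ Filter.cofinite ⊓ Filter.principal S := Ultrafilter.of_le _
  have hUS : S ∈ U := hU (Filter.mem_inf_of_right (Filter.mem_principal_self S))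
  have hUF : ∀ x, (F x)ᶜ ∈ U := fun x =>
    hU (Filter.mem_inf_of_left (hF x).compl_mem_cofinite)
  have key : ∀ R' : α → α → Prop, {x | {y | R' x y} ∈ U} ∈ U →
      ∃ f : ℕ → α, (∀ n, f n ∈ S) ∧ (∀ m n, m < n → f n ∉ F (f m)) ∧
        ∀ m n, m < n → R' (f m) (f n) := by
    intro R' hR'
    obtain ⟨f, hf, hr⟩ := exists_seq_of_forall_finset_exists
      (fun x => x ∈ S ∧ {y | R' x y} ∈ U) (fun x y => y ∉ F x ∧ R' x y) (by
        intro s hs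
        have h : ((S ∩ {x | {y | R' x y} ∈ U}) ∩
            ⋂ x ∈ s, ((F x)ᶜ ∩ {y | R' x y})) ∈ (U : Filter α) := by
          refine Filter.inter_mem (Filter.inter_mem hUS hR') ?_
          rw [Filter.biInter_finset_mem]
          exact fun x hx => Filter.inter_mem (hUF x) (hs x hx).2
        obtain ⟨y, hy1, hy2⟩ := U.neBot.nonempty_of_mem h
        simp only [Set.mem_iInter] at hy2
        exact ⟨y, hy1, fun x hx => hy2 x hx⟩)
    exact ⟨f, fun n => (hf n).1, fun m n h => (hr m n h).1, fun m n h => (hr m n h).2⟩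
  rcases U.mem_or_compl_mem {x | {y | R x y} ∈ U} with h | h
  · obtain ⟨f, h1, h2, h3⟩ := key R h
    exact ⟨f, h1, h2, Or.inl h3⟩
  · have h' : {x | {y | ¬ R x y} ∈ U} ∈ U := by
      filter_upwards [h] with x hx
      exact Ultrafilter.compl_mem_iff_notMem.2 hx
    obtain ⟨f, h1, h2, h3⟩ := key (fun x y => ¬ R x y) h'
    exact ⟨f, h1, h2, Or.inr h3⟩

namespace SplittingPoset

/-- `Q` is isomorphic to a suborder of `P` (not necessarily downward closed), on which the
splitting numbers are bounded by those of `P`. -/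
def Embeds (Q : SplittingPoset.{v}) (P : SplittingPoset.{u}) : Prop :=
  ∃ φ : Q.carrier → P.carrier, (∀ a b, φ a ≤ φ b ↔ a ≤ b) ∧ ∀ a, Q.δ a ≤ P.δ (φ a)

variable {P : SplittingPoset.{u}}

theorem benchmark₀_embeds (f : ℕ → P.carrier) (hf : ∀ m n, m < n → f m < f n) :
    benchmark₀.Embeds P :=
  ⟨f, fun a b => (strictMono_nat_of_lt_succ fun n => hf n _ n.lt_succ_self).le_iff_le
    (a := a) (b := b), fun _ => P.two_le_δ _⟩

theorem benchmark₁_embeds (f : ℕ → P.carrier) (hf : ∀ m n, f m ≤ f n → m = n)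
    (h3 : ∀ n, 3 ≤ P.δ (f n)) : benchmark₁.Embeds P :=
  ⟨f, fun a b => ⟨fun h => hf a b h, fun h => (congrArg f (h : @Eq ℕ a b)).le⟩, h3⟩

theorem PQ_embeds {r : ℕ → ℕ → Prop} {f g : ℕ → P.carrier}
    (hf : ∀ m n, f m ≤ f n → m = n) (hg : ∀ m n, g m ≤ g n → m = n)
    (hgf : ∀ m n, ¬ g m ≤ f n) (hfg : ∀ m n, f m ≤ g n ↔ r m n) :
    letI := PQ.order r
    ∀ a b : PQ, (PQ.rec f g a : P.carrier) ≤ PQ.rec f g b ↔ a ≤ b := by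
  rintro (m | m) (n | n)
  · refine ⟨fun h => Or.inl (congrArg _ (hf m n h)), ?_⟩
    rintro (h | ⟨_, _, _, _, h⟩) <;> cases h
    exact le_rfl
  · refine ⟨fun h => Or.inr ⟨m, n, (hfg m n).1 h, rfl, rfl⟩, ?_⟩
    rintro (h | ⟨_, _, hr, h, h'⟩)
    · cases h
    · cases h
      cases h'
      exact (hfg m n).2 hr
  · refine ⟨fun h => (hgf m n h).elim, ?_⟩
    rintro (h | ⟨_, _, _, h, _⟩) <;> cases h
  · refine ⟨fun h => Or.inl (congrArg _ (hg m n h)), ?_⟩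
    rintro (h | ⟨_, _, _, h, _⟩) <;> cases h
    exact le_rfl

/-- An infinite subset of `P` contains an infinite chain, ordered as `ℕ`, or an infinite
antichain. It does not matter where the chain lies. -/
theorem exists_chain_or_antichain {S : Set P.carrier} (hS : S.Infinite) :
    (∃ f : ℕ → P.carrier, ∀ m n, m < n → f m < f n) ∨
      ∃ f : ℕ → P.carrier, (∀ n, f n ∈ S) ∧ ∀ m n, f m ≤ f n → m = n := by
  obtain ⟨f, hfS, hF, h | h⟩ := exists_seq_homogeneous hS Set.Iic P.finite_Iic (· ≤ ·)
  · exact Or.inl ⟨f, fun m n hmn => lt_of_le_not_ge (h m n hmn) (hF m n hmn)⟩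
  · refine Or.inr ⟨f, hfS, fun m n hmn => ?_⟩
    rcases lt_trichotomy m n with h' | h' | h'
    · exact (h m n h' hmn).elim
    · exact h'
    · exact (hF n m h' hmn).elim

/-- An antichain of nonmaximal elements `f n`, with elements `s n` above them, yields a chain or
one of the two benchmarks of height two. -/
theorem exists_benchmark_embeds_of_not_isMax (f s : ℕ → P.carrier)
    (hf : ∀ m n, f m ≤ f n → m = n) (hs : ∀ n, f n < s n) :
    ∃ i, (benchmark i).Embeds P := by
  have hinj : Function.Injective f := fun m n h => hf m n h.le
  have hfin : ∀ n, {m | f m ≤ s n}.Finite := fun n =>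
    (P.finite_Iic (s n)).preimage hinj.injOn
  obtain ⟨e, -, he, h⟩ := exists_seq_homogeneous Set.infinite_univ _ hfin fun m n => s m ≤ s n
  have hes : ∀ m n, m < n → ¬ s (e n) ≤ s (e m) := fun m n hmn h' =>
    he m n hmn ((hs _).le.trans h')
  rcases h with h | h
  · exact ⟨0, benchmark₀_embeds (fun n => s (e n)) fun m n hmn =>
      lt_of_le_not_ge (h m n hmn) (hes m n hmn)⟩
  -- Now the `s (e n)` form an antichain too.
  have hsanti : ∀ m n, s (e m) ≤ s (e n) → m = n := by
    intro m n hmn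
    rcases lt_trichotomy m n with h' | h' | h'
    · exact (h m n h' hmn).elim
    · exact h'
    · exact (hes n m h' hmn).elim
  have heinj : Function.Injective e := fun m n hmn => hsanti m n (by rw [hmn])
  obtain ⟨d, -, hd, h⟩ := exists_seq_homogeneous Set.infinite_univ
    (fun n => {m | f (e m) ≤ s (e n)}) (fun n => (hfin (e n)).preimage heinj.injOn)
    fun m n => f (e m) ≤ s (e n)
  have hdinj : Function.Injective d := by
    have hlt : ∀ m n, m < n → d m ≠ d n := fun m n hmn hmn' => hd m n hmn <| by
      rw [← hmn']
      exact (hs _).le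
    intro m n hmn
    by_contra hne
    rcases lt_or_gt_of_ne hne with h' | h'
    · exact hlt m n h' hmn
    · exact hlt n m h' hmn.symm
  have h1 : ∀ m n, f (e (d m)) ≤ f (e (d n)) → m = n := fun m n hmn =>
    hdinj (heinj (hf _ _ hmn))
  have h2 : ∀ m n, s (e (d m)) ≤ s (e (d n)) → m = n := fun m n hmn =>
    hdinj (hsanti _ _ hmn)
  have h3 : ∀ m n, ¬ s (e (d m)) ≤ f (e (d n)) := by
    intro m n hmn
    obtain rfl := h1 m n ((hs _).le.trans hmn)
    exact (hs _).not_ge hmn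
  have h4 : ∀ m n, n < m → ¬ f (e (d m)) ≤ s (e (d n)) := fun m n hmn => hd n m hmn
  rcases h with h | h
  · refine ⟨3, _, PQ_embeds (r := fun n m => n ≤ m) h1 h2 h3 fun m n => ?_,
      fun _ => P.two_le_δ _⟩
    rcases lt_trichotomy m n with h' | rfl | h'
    · exact iff_of_true (h m n h') h'.le
    · exact iff_of_true (hs _).le le_rfl
    · exact iff_of_false (h4 m n h') h'.not_ge
  · refine ⟨2, _, PQ_embeds (r := fun n m => n = m) h1 h2 h3 fun m n => ?_,
      fun _ => P.two_le_δ _⟩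
    rcases lt_trichotomy m n with h' | rfl | h'
    · exact iff_of_false (h m n h') h'.ne
    · exact iff_of_true (hs _).le rfl
    · exact iff_of_false (h4 m n h') h'.ne'

theorem exists_benchmark_embeds (hP : ¬ P.NearlyBinaryCrosscutting) :
    ∃ i, (benchmark i).Embeds P := by
  by_cases h3 : {p | 3 ≤ P.δ p}.Infinite
  · rcases exists_chain_or_antichain h3 with ⟨f, hf⟩ | ⟨f, hf3, hf⟩
    · exact ⟨0, benchmark₀_embeds f hf⟩
    · exact ⟨1, benchmark₁_embeds f hf hf3⟩
  · have hmax : {p : P.carrier | ¬ IsMax p}.Infinite := by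
      intro hfin
      refine hP ((hfin.union (Set.not_infinite.1 h3)).subset fun p hp => ?_)
      by_cases h : IsMax p
      · exact Or.inr ((P.two_le_δ p).lt_of_ne fun h2 => hp ⟨h, h2.symm⟩)
      · exact Or.inl h
    rcases exists_chain_or_antichain hmax with ⟨f, hf⟩ | ⟨f, hfm, hf⟩
    · exact ⟨0, benchmark₀_embeds f hf⟩
    · choose s hs using fun n => not_isMax_iff.1 (hfm n)
      exact exists_benchmark_embeds_of_not_isMax f s hf hs

end SplittingPoset

/-! ### Changing the index order of a splitting system -/

section Reindex

variable {ι : Type u} {κ : Type v} {X : Type w} {φ : κ → ι} {c : κ → ℕ} {E : κ → X → X → Prop}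

open Classical in
/-- The splitting numbers of a system indexed by a suborder `φ : κ → ι`, viewed as a system
indexed by `ι`: there is no splitting at indices outside the range of `φ`. -/
noncomputable def reindexSplit (φ : κ → ι) (c : κ → ℕ) (p : ι) : ℕ :=
  if h : ∃ q, φ q = p then c h.choose else 1

theorem reindexSplit_apply (hφ : Function.Injective φ) (q : κ) :
    reindexSplit φ c (φ q) = c q := by
  have h : ∃ q', φ q' = φ q := ⟨q, rfl⟩
  rw [reindexSplit, dif_pos h, hφ h.choose_spec]

theorem reindexSplit_of_notMem {p : ι} (hp : ¬ ∃ q, φ q = p) : reindexSplit φ c p = 1 := by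
  rw [reindexSplit, dif_neg hp]

variable [PartialOrder ι]

/-- A system indexed by a suborder `φ : κ → ι`, viewed as a system indexed by `ι`: the new relation
at `p` is the intersection of the old ones at the indices below `p`. -/
def reindexRel (φ : κ → ι) (E : κ → X → X → Prop) (p : ι) (x y : X) : Prop :=
  ∀ q, φ q ≤ p → E q x y

theorem Separates.reindex (h : Separates E) : Separates (reindexRel φ E) :=
  fun x y hxy => h x y fun q => hxy (φ q) q le_rfl

variable [PartialOrder κ]

theorem IsSplittingSystem.reindexRel_apply (h : IsSplittingSystem c E)
    (hφ : ∀ a b, φ a ≤ φ b ↔ a ≤ b) (q : κ) (x y : X) :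
    reindexRel φ E (φ q) x y ↔ E q x y :=
  ⟨fun hxy => hxy q le_rfl, fun hxy _ hr => h.mono ((hφ _ _).1 hr) hxy⟩

theorem IsSplittingSystem.reindex (h : IsSplittingSystem c E) (hφ : ∀ a b, φ a ≤ φ b ↔ a ≤ b) :
    IsSplittingSystem (reindexSplit φ c) (reindexRel φ E) := by
  have hinj : Function.Injective φ := fun a b hab =>
    le_antisymm ((hφ _ _).1 hab.le) ((hφ _ _).1 hab.ge)
  have hlt : ∀ {a b}, φ a < φ b ↔ a < b := fun {a b} => by
    rw [lt_iff_le_not_ge, lt_iff_le_not_ge, hφ, hφ]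
  refine ⟨fun p => ⟨fun x q _ => (h.equiv q).refl x, fun hxy q hq => (h.equiv q).symm (hxy q hq),
    fun hxy hyz q hq => (h.equiv q).trans (hxy q hq) (hyz q hq)⟩,
    fun hrp _ _ hxy q hq => hxy q (hq.trans hrp), fun p x => ?_, fun R hR a ha => ?_⟩
  · by_cases hp : ∃ q, φ q = p
    · obtain ⟨q, rfl⟩ := hp
      obtain ⟨w, h1, h2, h3⟩ := h.split q x
      rw [reindexSplit_apply hinj]
      refine ⟨w, fun i hi r hr q' hq' => h1 i hi q' (hlt.1 (hq'.trans_lt hr)),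
        fun i hi j hj hij hE => h2 i hi j hj hij (hE q le_rfl), fun z hz => ?_⟩
      obtain ⟨i, hi, hE⟩ := h3 z fun r hr => hz (φ r) (hlt.2 hr) r le_rfl
      exact ⟨i, hi, (h.reindexRel_apply hφ _ _ _).2 hE⟩
    · rw [reindexSplit_of_notMem hp]
      refine ⟨fun _ => x, fun _ _ _ _ q _ => (h.equiv q).refl x, fun i hi j hj hij => ?_,
        fun z hz => ⟨0, zero_lt_one, fun q hq => ?_⟩⟩
      · omega
      · exact hz (φ q) (hq.lt_of_ne fun e => hp ⟨q, e⟩) q le_rfl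
  · obtain ⟨z, hz⟩ := h.amalgam (R.preimage φ hinj.injOn)
      (fun a b hba ha => by
        simp only [Finset.coe_preimage, Set.mem_preimage] at ha ⊢
        exact hR ((hφ _ _).2 hba) ha) (fun q => a (φ q))
      (fun r hr q hq hrq => ha _ (by simpa using hr) _ (by simpa using hq) ((hφ _ _).2 hrq) r
        le_rfl)
    refine ⟨z, fun r hr q hq => ?_⟩
    have hqR : φ q ∈ R := hR hq hr
    exact (h.equiv q).trans (hz q (by simpa using hqR)) (ha _ hqR _ hr hq q le_rfl)

end Reindex

/-! ### Increasing the splitting numbers -/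

section Enlarge

variable {ι : Type u} {X : Type w} {b d : ι → ℕ} {C : ℕ → X → Prop}

/-- Finitely supported elements of the product of the sets `{0, …, d p - 1}`. -/
def Defect (d : ι → ℕ) : Type u := {g : ι →₀ ℕ // ∀ p, g p < d p}

instance [Countable ι] : Countable (Defect d) := inferInstanceAs (Countable {_g : ι →₀ ℕ // _})

namespace Defect

/-- The zero element. -/
def zero (hd : ∀ p, 0 < d p) : Defect d := ⟨0, hd⟩

open Classical in
/-- Replaces the value of `g` at `q` by `i`, if this is allowed. -/
noncomputable def set (g : Defect d) (q : ι) (i : ℕ) : Defect d :=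
  ⟨g.1.update q (if i < d q then i else g.1 q), fun p => by
    by_cases hp : p = q
    · subst hp
      rw [Finsupp.update_apply, if_pos rfl]
      split_ifs with h
      exacts [h, g.2 p]
    · rw [Finsupp.update_apply, if_neg hp]
      exact g.2 p⟩

theorem set_self (g : Defect d) {q : ι} {i : ℕ} (hi : i < d q) : (g.set q i).1 q = i := by
  classical
  simp [set, Finsupp.update_apply, hi]

theorem set_of_ne (g : Defect d) {q r : ι} (i : ℕ) (hr : r ≠ q) : (g.set q i).1 r = g.1 r := by
  classical
  simp [set, Finsupp.update_apply, hr]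

variable [PartialOrder ι]

/-- The index `p` is spoiled by `g` if, at some index below `p`, the value of `g` is one of the
labels exceeding the splitting number `b`. -/
def Spoiled (b : ι → ℕ) (g : Defect d) (p : ι) : Prop := ∃ r ≤ p, b r ≤ g.1 r

theorem Spoiled.mono {g : Defect d} {p q : ι} (h : g.Spoiled b p) (hpq : p ≤ q) :
    g.Spoiled b q :=
  h.imp fun _ hr => ⟨hr.1.trans hpq, hr.2⟩

theorem spoiled_congr {g g' : Defect d} {p : ι} (h : ∀ r ≤ p, g.1 r = g'.1 r) :
    g.Spoiled b p ↔ g'.Spoiled b p :=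
  exists_congr fun r => and_congr_right fun hr => by rw [h r hr]

theorem not_spoiled_zero (hb : ∀ p, 0 < b p) (hd : ∀ p, 0 < d p) (p : ι) :
    ¬ (zero hd).Spoiled b p := fun ⟨r, _, hr⟩ => (hb r).not_ge hr

end Defect

/-- The coloring of the enlargement: color `0` is reserved for the elements that are spoiled
somewhere. -/
def enlargeColor (b : ι → ℕ) (C : ℕ → X → Prop) (k : ℕ) (x : X × Defect d) : Prop :=
  ((∃ r, b r ≤ x.2.1 r) ∧ k = 0) ∨ ((¬ ∃ r, b r ≤ x.2.1 r) ∧ ∃ l, k = l + 1 ∧ C l x.1)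

theorem IsColoring.enlarge (hC : IsColoring C) :
    IsColoring (enlargeColor (d := d) b C) := by
  intro x
  by_cases hx : ∃ r, b r ≤ x.2.1 r
  · refine ⟨0, Or.inl ⟨hx, rfl⟩, fun k hk => ?_⟩
    rcases hk with hk | hk
    exacts [hk.2, (hk.1 hx).elim]
  · obtain ⟨l, hl, hu⟩ := hC x.1
    refine ⟨l + 1, Or.inr ⟨hx, l, rfl, hl⟩, fun k hk => ?_⟩
    rcases hk with hk | ⟨-, l', rfl, hl'⟩
    · exact (hx hk.1).elim
    · rw [hu l' hl']

theorem enlargeColor_succ_zero (hb : ∀ p, 0 < b p) (hd : ∀ p, 0 < d p) (k : ℕ) (x : X) :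
    enlargeColor b C (k + 1) (x, Defect.zero hd) ↔ C k x := by
  have h : ¬ ∃ r, b r ≤ (Defect.zero hd).1 r := fun ⟨r, hr⟩ => (hb r).not_ge hr
  simp [enlargeColor, h]

theorem enlargeColor_zero_iff {x : X × Defect d} :
    enlargeColor b C 0 x ↔ ∃ r, b r ≤ x.2.1 r := by
  simp [enlargeColor]

open Defect

variable [PartialOrder ι]

/-- The enlargement of a system `E` with splitting numbers `b` to one with splitting numbers `d`.
An element `(x, g)` follows `x` as long as it is not spoiled, and from then on has the labels
given by `g`. The relation at `p` says that the two elements cannot be distinguished below `p`. -/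
def enlargeRel (b : ι → ℕ) (E : ι → X → X → Prop) (p : ι) (x y : X × Defect d) : Prop :=
  ∀ r ≤ p, (x.2.Spoiled b r ↔ y.2.Spoiled b r) ∧ (x.2.Spoiled b r → x.2.1 r = y.2.1 r) ∧
    (¬ x.2.Spoiled b r → E r x.1 y.1)

variable {E : ι → X → X → Prop}

theorem enlargeRel_equivalence (hE : ∀ p, Equivalence (E p)) (p : ι) :
    Equivalence (enlargeRel (d := d) b E p) := by
  refine ⟨fun x r _ => ⟨Iff.rfl, fun _ => rfl, fun _ => (hE r).refl _⟩, fun h r hr => ?_,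
    fun h h' r hr => ?_⟩
  · obtain ⟨h1, h2, h3⟩ := h r hr
    exact ⟨h1.symm, fun hs => (h2 (h1.2 hs)).symm, fun hs => (hE r).symm (h3 (mt h1.1 hs))⟩
  · obtain ⟨h1, h2, h3⟩ := h r hr
    obtain ⟨h1', h2', h3'⟩ := h' r hr
    exact ⟨h1.trans h1', fun hs => (h2 hs).trans (h2' (h1.1 hs)),
      fun hs => (hE r).trans (h3 hs) (h3' (mt h1.2 hs))⟩

theorem enlargeRel_self_iff {p : ι} {x y : X × Defect d} :
    enlargeRel b E p x y ↔ (∀ r < p, enlargeRel b E r x y) ∧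
      (x.2.Spoiled b p ↔ y.2.Spoiled b p) ∧ (x.2.Spoiled b p → x.2.1 p = y.2.1 p) ∧
      (¬ x.2.Spoiled b p → E p x.1 y.1) := by
  refine ⟨fun h => ⟨fun r hr s hs => h s (hs.trans hr.le), h p le_rfl⟩, fun h r hr => ?_⟩
  rcases hr.lt_or_eq with hr | rfl
  · exact h.1 r hr r le_rfl
  · exact h.2

/-- Below `q`, setting the value at `q` has no effect. -/
theorem enlargeRel_set {r q : ι} (hr : r < q) (x y : X) (g : Defect d) (i : ℕ)
    (h : ∀ s ≤ r, E s x y) : enlargeRel b E r (x, g) (y, g.set q i) := by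
  intro s hs
  have hg : ∀ t ≤ s, g.1 t = (g.set q i).1 t := fun t ht =>
    (g.set_of_ne i ((ht.trans hs).trans_lt hr).ne).symm
  exact ⟨spoiled_congr hg, fun _ => hg s le_rfl, fun _ => h s hs⟩

/-- For the splitting at `q`: a class which is spoiled below `q` splits according to the value
at `q`. Otherwise the labels `i < b q` name the classes of the original system, and the labels
`i ≥ b q` create the new, spoiled classes. -/
theorem IsSplittingSystem.enlarge (h : IsSplittingSystem b E) (hb : ∀ p, 0 < b p)
    (hbd : ∀ p, b p ≤ d p) : IsSplittingSystem d (enlargeRel (d := d) b E) := by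
  classical
  have hequiv := enlargeRel_equivalence (d := d) (b := b) h.equiv
  refine ⟨hequiv, fun hrq _ _ hxy s hs => hxy s (hs.trans hrq), ?_, fun R hR a ha => ?_⟩
  · rintro q ⟨x, g⟩
    obtain ⟨w, h1, h2, h3⟩ := h.split q x
    let y : ℕ → X := fun i => if i < b q then w i else x
    have hyw : ∀ i < b q, y i = w i := fun i hi => if_pos hi
    have hy : ∀ i, ∀ r < q, E r x (y i) := by
      intro i r hr
      by_cases hi : i < b q
      · rw [hyw i hi]
        exact h1 i hi r hr
      · simpa [y, hi] using (h.equiv r).refl x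
    have hlow : ∀ i, ∀ r < q, enlargeRel b E r (x, g) (y i, g.set q i) := fun i r hr =>
      enlargeRel_set hr _ _ _ _ fun s hs => hy i s (hs.trans_lt hr)
    have hsp : ∀ i < d q, (g.set q i).Spoiled b q ↔ (∃ r < q, b r ≤ g.1 r) ∨ b q ≤ i := by
      intro i hi
      constructor
      · rintro ⟨r, hr, hbr⟩
        rcases hr.lt_or_eq with hr | rfl
        · exact Or.inl ⟨r, hr, by rwa [g.set_of_ne i hr.ne] at hbr⟩
        · exact Or.inr (by rwa [g.set_self hi] at hbr)
      · rintro (⟨r, hr, hbr⟩ | hbi)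
        · exact ⟨r, hr.le, by rwa [g.set_of_ne i hr.ne]⟩
        · exact ⟨q, le_rfl, by rwa [g.set_self hi]⟩
    refine ⟨fun i => (y i, g.set q i), fun i _ => hlow i, fun i hi j hj hij hE => ?_,
      fun z hz => ?_⟩
    · obtain ⟨e1, e2, e3⟩ := hE q le_rfl
      dsimp only at e1 e2 e3
      rw [g.set_self hi, g.set_self hj] at e2
      have hi' : ¬ (g.set q i).Spoiled b q := fun hs => hij (e2 hs)
      have hj' : ¬ (g.set q j).Spoiled b q := fun hs => hij (e2 (e1.2 hs))
      have hib : i < b q := by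
        by_contra hib
        exact hi' ((hsp i hi).2 (Or.inr (not_lt.1 hib)))
      have hjb : j < b q := by
        by_contra hjb
        exact hj' ((hsp j hj).2 (Or.inr (not_lt.1 hjb)))
      refine h2 i hib j hjb hij ?_
      rw [← hyw i hib, ← hyw j hjb]
      exact e3 hi'
    · have hzg : (∃ r < q, b r ≤ z.2.1 r) ↔ ∃ r < q, b r ≤ g.1 r := by
        constructor
        · rintro ⟨r, hr, hbr⟩
          obtain ⟨s, hs, hbs⟩ := (hz r hr r le_rfl).1.2 ⟨r, le_rfl, hbr⟩
          exact ⟨s, hs.trans_lt hr, hbs⟩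
        · rintro ⟨r, hr, hbr⟩
          obtain ⟨s, hs, hbs⟩ := (hz r hr r le_rfl).1.1 ⟨r, le_rfl, hbr⟩
          exact ⟨s, hs.trans_lt hr, hbs⟩
      have hlow' : ∀ i, ∀ r < q, enlargeRel b E r (y i, g.set q i) z := fun i r hr =>
        (hequiv r).trans ((hequiv r).symm (hlow i r hr)) (hz r hr)
      by_cases hzq : z.2.Spoiled b q
      · have hs : (g.set q (z.2.1 q)).Spoiled b q := by
          rw [hsp _ (z.2.2 q), ← hzg]
          obtain ⟨r, hr, hbr⟩ := hzq
          rcases hr.lt_or_eq with hr | rfl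
          · exact Or.inl ⟨r, hr, hbr⟩
          · exact Or.inr hbr
        exact ⟨z.2.1 q, z.2.2 q, enlargeRel_self_iff.2 ⟨hlow' _, iff_of_true hs hzq,
          fun _ => g.set_self (z.2.2 q), fun hs' => (hs' hs).elim⟩⟩
      · have hg : ¬ ∃ r < q, b r ≤ g.1 r := by
          rw [← hzg]
          exact fun ⟨r, hr, hbr⟩ => hzq ⟨r, hr.le, hbr⟩
        obtain ⟨i, hi, hE⟩ := h3 z.1 fun r hr =>
          (hz r hr r le_rfl).2.2 fun ⟨s, hs, hbs⟩ => hg ⟨s, hs.trans_lt hr, hbs⟩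
        have hid : i < d q := hi.trans_le (hbd q)
        have hs : ¬ (g.set q i).Spoiled b q := by
          rw [hsp i hid]
          exact not_or_intro hg hi.not_ge
        refine ⟨i, hid, enlargeRel_self_iff.2 ⟨hlow' _, iff_of_false hs hzq,
          fun hs' => (hs hs').elim, fun _ => ?_⟩⟩
        simpa only [hyw i hi] using hE
  · -- Amalgamate the unspoiled part in the original system, and copy the labels of the
    -- spoiled part.
    obtain ⟨m, hm⟩ := h.amalgam (R.filter fun r => ¬ (a r).2.Spoiled b r)
      (fun r s hsr hr => by
        simp only [Finset.coe_filter, Set.mem_ofPred_eq] at hr ⊢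
        have hsR : s ∈ R := hR hsr hr.1
        exact ⟨hsR, fun hs => hr.2
          (((ha s hsR r hr.1 hsr s le_rfl).1.1 hs).mono hsr)⟩)
      (fun r => (a r).1)
      (fun r hr q hq hrq => by
        simp only [Finset.mem_filter] at hr hq
        exact (ha r hr.1 q hq.1 hrq r le_rfl).2.2 hr.2)
    let g : Defect d := ⟨Finsupp.onFinset R
      (fun r => if r ∈ R ∧ (a r).2.Spoiled b r then (a r).2.1 r else 0)
      (fun r hr => by
        by_contra hrR
        simp [hrR] at hr), fun r => by
        rw [Finsupp.onFinset_apply]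
        split_ifs
        exacts [(a r).2.2 r, (hb r).trans_le (hbd r)]⟩
    have hg : ∀ r, g.1 r = if r ∈ R ∧ (a r).2.Spoiled b r then (a r).2.1 r else 0 := fun r => rfl
    have hgs : ∀ r ∈ R, g.Spoiled b r ↔ (a r).2.Spoiled b r := by
      intro r hr
      constructor
      · rintro ⟨s, hs, hbs⟩
        rw [hg] at hbs
        split_ifs at hbs with h'
        · exact ((ha s h'.1 r hr hs s le_rfl).1.1 h'.2).mono hs
        · exact ((hb s).not_ge hbs).elim
      · rintro ⟨s, hs, hbs⟩
        have hsR : s ∈ R := hR hs hr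
        obtain ⟨h1, h2, -⟩ := ha s hsR r hr hs s le_rfl
        have h3 : (a s).2.Spoiled b s := h1.2 ⟨s, le_rfl, hbs⟩
        refine ⟨s, hs, ?_⟩
        rw [hg, if_pos ⟨hsR, h3⟩, h2 h3]
        exact hbs
    refine ⟨(m, g), fun q hq => ?_⟩
    have hself : ∀ r ∈ R, (g.Spoiled b r ↔ (a r).2.Spoiled b r) ∧
        (g.Spoiled b r → g.1 r = (a r).2.1 r) ∧ (¬ g.Spoiled b r → E r m (a r).1) := by
      refine fun r hr => ⟨hgs r hr, fun hs => ?_, fun hs => ?_⟩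
      · rw [hg, if_pos ⟨hr, (hgs r hr).1 hs⟩]
      · exact hm r (Finset.mem_filter.2 ⟨hr, mt (hgs r hr).2 hs⟩)
    intro r hr
    have hrR : r ∈ R := hR hr hq
    obtain ⟨h1, h2, h3⟩ := hself r hrR
    obtain ⟨h1', h2', h3'⟩ := ha r hrR q hq hr r le_rfl
    exact ⟨h1.trans h1', fun hs => (h2 hs).trans (h2' (h1.1 hs)),
      fun hs => (h.equiv r).trans (h3 hs) (h3' (mt h1.2 hs))⟩

theorem IsSplittingSystem.enlargeRel_zero_iff (h : IsSplittingSystem b E) (hb : ∀ p, 0 < b p)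
    (hd : ∀ p, 0 < d p) {p : ι} {x y : X} :
    enlargeRel b E p (x, Defect.zero hd) (y, Defect.zero hd) ↔ E p x y :=
  ⟨fun hxy => (hxy p le_rfl).2.2 (not_spoiled_zero hb hd p),
    fun hxy _ hr => ⟨Iff.rfl, fun _ => rfl, fun _ => h.mono hr hxy⟩⟩

theorem enlargeRel_zero_of_unspoiled (hE : ∀ p, Equivalence (E p)) (hb : ∀ p, 0 < b p)
    (hd : ∀ p, 0 < d p) {x : X × Defect d} (hx : ¬ ∃ r, b r ≤ x.2.1 r) (p : ι) :
    enlargeRel b E p x (x.1, Defect.zero hd) := by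
  have hs : ∀ r, ¬ x.2.Spoiled b r := fun r ⟨s, _, hs⟩ => hx ⟨s, hs⟩
  exact fun r _ => ⟨iff_of_false (hs r) (not_spoiled_zero hb hd r), fun h => (hs r h).elim,
    fun _ => (hE r).refl _⟩

theorem enlargeColor_congr (hE : Separates E) {x y : X × Defect d}
    (hxy : ∀ p, enlargeRel b E p x y) (k : ℕ) :
    enlargeColor b C k x ↔ enlargeColor b C k y := by
  have hs : ∀ g : Defect d, (∃ r, b r ≤ g.1 r) ↔ ∃ r, g.Spoiled b r := fun g =>
    ⟨fun ⟨r, hr⟩ => ⟨r, r, le_rfl, hr⟩, fun ⟨_, s, _, hs⟩ => ⟨s, hs⟩⟩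
  have h1 : (∃ r, b r ≤ x.2.1 r) ↔ ∃ r, b r ≤ y.2.1 r := by
    rw [hs, hs]
    exact exists_congr fun r => (hxy r r le_rfl).1
  unfold enlargeColor
  rw [h1]
  refine or_congr Iff.rfl (and_congr_right fun hy => ?_)
  have hxs : ∀ r, ¬ x.2.Spoiled b r := fun r hr => (mt h1.1 hy) ((hs _).2 ⟨r, hr⟩)
  rw [hE x.1 y.1 fun p => (hxy p p le_rfl).2.2 (hxs p)]

end Enlarge

/-! ### Isomorphism of colored systems -/

section SystemIso

variable {ι : Type u} {X : Type v} {Y : Type w} {Z : Type x}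

/-- Isomorphism of colored systems of relations with the same index set. -/
def SystemIso (E : ι → X → X → Prop) (C : ℕ → X → Prop) (E' : ι → Y → Y → Prop)
    (C' : ℕ → Y → Prop) : Prop :=
  ∃ σ : X ≃ Y, (∀ p x y, E p x y ↔ E' p (σ x) (σ y)) ∧ ∀ k x, C k x ↔ C' k (σ x)

variable {E : ι → X → X → Prop} {C : ℕ → X → Prop} {E' : ι → Y → Y → Prop} {C' : ℕ → Y → Prop}
  {E'' : ι → Z → Z → Prop} {C'' : ℕ → Z → Prop}

theorem SystemIso.symm (h : SystemIso E C E' C') : SystemIso E' C' E C := by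
  obtain ⟨σ, h1, h2⟩ := h
  exact ⟨σ.symm, fun p x y => by simp [h1], fun k x => by simp [h2]⟩

theorem SystemIso.trans (h : SystemIso E C E' C') (h' : SystemIso E' C' E'' C'') :
    SystemIso E C E'' C'' := by
  obtain ⟨σ, h1, h2⟩ := h
  obtain ⟨τ, h3, h4⟩ := h'
  exact ⟨σ.trans τ, fun p x y => (h1 p x y).trans (h3 p _ _),
    fun k x => (h2 k x).trans (h4 k _)⟩

theorem SystemIso.enlarge [PartialOrder ι] (b d : ι → ℕ) (h : SystemIso E C E' C') :
    SystemIso (enlargeRel (d := d) b E) (enlargeColor b C) (enlargeRel (d := d) b E')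
      (enlargeColor b C') := by
  obtain ⟨σ, h1, h2⟩ := h
  refine ⟨σ.prodCongr (Equiv.refl _), fun p x y => ?_, fun k x => ?_⟩
  · simp [enlargeRel, h1]
  · simp [enlargeColor, h2]

/-- An isomorphism restricts to the elements which do not have color `0`; the remaining colors
are shifted by one. -/
theorem SystemIso.restrict (h : SystemIso E C E' C') :
    SystemIso (X := {x // ¬ C 0 x}) (Y := {y // ¬ C' 0 y}) (fun p x y => E p x y)
      (fun k x => C (k + 1) x) (fun p x y => E' p x y) fun k y => C' (k + 1) y := by
  obtain ⟨σ, h1, h2⟩ := h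
  exact ⟨σ.subtypeEquiv fun x => not_congr (h2 0 x), fun p x y => h1 p x y,
    fun k x => h2 (k + 1) x⟩

theorem systemIso_reindex_iff {κ : Type u'} [PartialOrder ι] [PartialOrder κ] {φ : κ → ι}
    (hφ : ∀ a b, φ a ≤ φ b ↔ a ≤ b) {c : κ → ℕ} {E : κ → X → X → Prop} {E' : κ → Y → Y → Prop}
    (hE : IsSplittingSystem c E) (hE' : IsSplittingSystem c E') :
    SystemIso (reindexRel φ E) C (reindexRel φ E') C' ↔ SystemIso E C E' C' := by
  constructor
  · rintro ⟨σ, h1, h2⟩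
    refine ⟨σ, fun q x y => ?_, h2⟩
    rw [← hE.reindexRel_apply hφ, h1, hE'.reindexRel_apply hφ]
  · rintro ⟨σ, h1, h2⟩
    exact ⟨σ, fun p x y => forall_congr' fun q => imp_congr_right fun _ => h1 q x y, h2⟩

end SystemIso

/-! ### Identifying inseparable elements -/

/-- `ν : Y → X` meets each class of the intersection of the relations `E p` exactly once. -/
structure IsTransversal {ι : Type u} {X : Type v} {Y : Type w} (E : ι → X → X → Prop)
    (ν : Y → X) : Prop where
  exists_rel : ∀ x, ∃ y, ∀ p, E p (ν y) x
  separates : Separates fun p y z => E p (ν y) (ν z)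

section Transversal

variable {ι : Type u} {X : Type v} {Y : Type w} {E : ι → X → X → Prop} {C : ℕ → X → Prop}
  {ν : Y → X}

theorem IsSplittingSystem.comap [PartialOrder ι] {b : ι → ℕ} (h : IsSplittingSystem b E)
    (hν : IsTransversal E ν) : IsSplittingSystem b fun p y z => E p (ν y) (ν z) := by
  choose f hf using hν.exists_rel
  refine ⟨fun p => (h.equiv p).comap ν, fun hrq _ _ => h.mono hrq, fun q y => ?_,
    fun R hR a ha => ?_⟩
  · obtain ⟨w, h1, h2, h3⟩ := h.split q (ν y)
    refine ⟨fun i => f (w i), fun i hi r hr => ?_, fun i hi j hj hij hE => ?_, fun z hz => ?_⟩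
    · exact (h.equiv r).trans (h1 i hi r hr) ((h.equiv r).symm (hf _ r))
    · exact h2 i hi j hj hij
        ((h.equiv q).trans ((h.equiv q).symm (hf _ q)) ((h.equiv q).trans hE (hf _ q)))
    · obtain ⟨i, hi, hE⟩ := h3 (ν z) hz
      exact ⟨i, hi, (h.equiv q).trans (hf _ q) hE⟩
  · obtain ⟨z, hz⟩ := h.amalgam R hR (fun r => ν (a r)) ha
    exact ⟨f z, fun q hq => (h.equiv q).trans (hf z q) (hz q hq)⟩

theorem SystemIso.comap {X' : Type x} {Y' : Type y} {E' : ι → X' → X' → Prop}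
    {C' : ℕ → X' → Prop} {ν' : Y' → X'}
    (hE' : ∀ p, Equivalence (E' p)) (hν : IsTransversal E ν) (hν' : IsTransversal E' ν')
    (hC : ∀ x y, (∀ p, E' p x y) → ∀ k, C' k x ↔ C' k y) (h : SystemIso E C E' C') :
    SystemIso (fun p y z => E p (ν y) (ν z)) (fun k y => C k (ν y))
      (fun p y z => E' p (ν' y) (ν' z)) fun k y => C' k (ν' y) := by
  obtain ⟨σ, h1, h2⟩ := h
  choose f hf using hν'.exists_rel
  have key : ∀ p y z, E p (ν y) (ν z) ↔ E' p (ν' (f (σ (ν y)))) (ν' (f (σ (ν z)))) := by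
    intro p y z
    rw [h1]
    exact ⟨fun h => (hE' p).trans (hf _ p) ((hE' p).trans h ((hE' p).symm (hf _ p))),
      fun h => (hE' p).trans ((hE' p).symm (hf _ p)) ((hE' p).trans h (hf _ p))⟩
  refine ⟨Equiv.ofBijective (fun y => f (σ (ν y))) ⟨fun y z hyz => ?_, fun y' => ?_⟩, key,
    fun k y => ?_⟩
  · refine hν.separates y z fun p => (key p y z).2 ?_
    simp only at hyz
    rw [hyz]
    exact (hE' p).refl _
  · obtain ⟨y, hy⟩ := hν.exists_rel (σ.symm (ν' y'))
    refine ⟨y, hν'.separates _ _ fun p => (hE' p).trans (hf _ p) ?_⟩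
    simpa [h1] using hy p
  · exact (h2 k _).trans (hC _ _ (hf _) k).symm

/-- A colored system is recovered from its enlargement as the part which does not have
color `0`. -/
theorem systemIso_restrict_enlarge [PartialOrder ι] {b d : ι → ℕ} (h : IsSplittingSystem b E)
    (hsep : Separates E) (hb : ∀ p, 0 < b p) (hd : ∀ p, 0 < d p) {ν : Y → X × Defect d}
    (hν : IsTransversal (enlargeRel b E) ν) :
    SystemIso (Y := {y // ¬ enlargeColor b C 0 (ν y)}) E C
      (fun p y z => enlargeRel b E p (ν y) (ν z)) fun k y => enlargeColor b C (k + 1) (ν y) := by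
  choose f hf using hν.exists_rel
  have hequiv := enlargeRel_equivalence (d := d) (b := b) h.equiv
  have hC : ∀ x y : X × Defect d, (∀ p, enlargeRel b E p x y) → ∀ k,
      (enlargeColor b C k x ↔ enlargeColor b C k y) := fun x y => enlargeColor_congr hsep
  have key : ∀ p x y, E p x y ↔
      enlargeRel b E p (ν (f (x, Defect.zero hd))) (ν (f (y, Defect.zero hd))) := by
    intro p x y
    rw [← h.enlargeRel_zero_iff hb hd]
    exact ⟨fun h => (hequiv p).trans (hf _ p) ((hequiv p).trans h ((hequiv p).symm (hf _ p))),
      fun h => (hequiv p).trans ((hequiv p).symm (hf _ p)) ((hequiv p).trans h (hf _ p))⟩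
  refine ⟨Equiv.ofBijective (fun x => ⟨f (x, Defect.zero hd), ?_⟩)
    ⟨fun x y hxy => ?_, fun y => ?_⟩, key, fun k x => ?_⟩
  · rw [hC _ _ (hf _), enlargeColor_zero_iff]
    exact fun ⟨r, hr⟩ => (hb r).not_ge hr
  · refine hsep x y fun p => (key p x y).2 ?_
    have hf' : f (x, Defect.zero hd) = f (y, Defect.zero hd) := congrArg Subtype.val hxy
    rw [hf']
    exact (hequiv p).refl _
  · refine ⟨(ν y).1, Subtype.ext (hν.separates _ _ fun p => ?_)⟩
    refine (hequiv p).trans (hf _ p) ((hequiv p).symm ?_)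
    exact enlargeRel_zero_of_unspoiled h.equiv hb hd (mt enlargeColor_zero_iff.2 y.2) p
  · exact (enlargeColor_succ_zero hb hd k x).symm.trans (hC _ _ (hf _) _).symm

/-- The least elements of the classes of the intersection of the relations `E p`, for relations
on a set enumerated by `e`. -/
def IsLeastRep (e : ℕ ≃ X) (E : ι → X → X → Prop) (n : ℕ) : Prop :=
  ∀ k < n, ¬ ∀ p, E p (e k) (e n)

/-- The enumeration of the least representatives. -/
noncomputable def leastRep (e : ℕ ≃ X) (E : ι → X → X → Prop) (i : ℕ) : X :=
  e (Nat.nth (IsLeastRep e E) i)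

theorem exists_isLeastRep (e : ℕ ≃ X) (hE : ∀ p, Equivalence (E p)) (x : X) :
    ∃ n, IsLeastRep e E n ∧ ∀ p, E p (e n) x := by
  classical
  have h : ∃ n, ∀ p, E p (e n) x := ⟨e.symm x, fun p => by simpa using (hE p).refl x⟩
  exact ⟨Nat.find h, fun k hk hkn =>
    Nat.find_min h hk fun p => (hE p).trans (hkn p) (Nat.find_spec h p), Nat.find_spec h⟩

/-- `f` witnesses that there are infinitely many classes. -/
theorem infinite_isLeastRep (e : ℕ ≃ X) (hE : ∀ p, Equivalence (E p)) {f : ℕ → X}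
    (hf : Separates fun p m n => E p (f m) (f n)) : (Set.ofPred (IsLeastRep e E)).Infinite := by
  choose g hg hgE using exists_isLeastRep e hE
  refine (Set.infinite_range_of_injective (f := fun m => g (f m)) fun m n hmn => ?_).mono ?_
  · refine hf m n fun p => (hE p).trans ((hE p).symm (hgE (f m) p)) ?_
    simp only at hmn
    rw [hmn]
    exact hgE _ p
  · rintro _ ⟨m, rfl⟩
    exact hg _

theorem isTransversal_leastRep (e : ℕ ≃ X) (hE : ∀ p, Equivalence (E p)) {f : ℕ → X}
    (hf : Separates fun p m n => E p (f m) (f n)) : IsTransversal E (leastRep e E) := by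
  have hinf := infinite_isLeastRep e hE hf
  refine ⟨fun x => ?_, fun i j hij => ?_⟩
  · obtain ⟨n, hn, hnE⟩ := exists_isLeastRep e hE x
    obtain ⟨i, rfl⟩ : n ∈ Set.range (Nat.nth (IsLeastRep e E)) := by
      rw [Nat.range_nth_of_infinite hinf]
      exact hn
    exact ⟨i, hnE⟩
  · have hlt : ∀ i j, i < j → ¬ ∀ p, E p (leastRep e E i) (leastRep e E j) := fun i j h =>
      Nat.nth_mem_of_infinite hinf j _ ((Nat.nth_lt_nth hinf).2 h)
    rcases lt_trichotomy i j with h | h | h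
    · exact (hlt i j h hij).elim
    · exact h
    · exact (hlt j i h fun p => (hE p).symm (hij p)).elim

end Transversal

/-! ### Borel maps between spaces of models -/

section Borel

variable {L : FirstOrder.Language.{u, v}}

theorem measurable_relMap {Φ : InfSentence L} {n : ℕ} (R : L.Relations n) (v : Fin n → ℕ) :
    Measurable fun M : Mod Φ => M.1.RelMap R v := by
  refine measurableSet_setOfPred.1 ?_
  refine MeasurableSpace.measurableSet_generateFrom ?_
  have h : IsOpen {M : L.Structure ℕ | M.RelMap R v} := by
    have hle : structureTopology L ≤
        TopologicalSpace.induced (fun M : L.Structure ℕ => M.RelMap R v) ⊥ :=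
      inf_le_right.trans ((iInf_le _ n).trans ((iInf_le _ R).trans (iInf_le _ v)))
    exact hle _ ⟨{True}, trivial, by ext; simp⟩
  exact h.preimage continuous_subtype_val

/-- For a countable relational language, the Borel structure on the space of models is generated
by the evaluations of the relation symbols. -/
theorem measurable_mod {Ω : Type w} [MeasurableSpace Ω] [∀ n, IsEmpty (L.Functions n)]
    [∀ n, Countable (L.Relations n)] {Ψ : InfSentence L} {f : Ω → Mod Ψ}
    (hf : ∀ (n : ℕ) (R : L.Relations n) (v : Fin n → ℕ),
      Measurable fun ω => (f ω).1.RelMap R v) : Measurable f := by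
  -- The subbasis of the topology, with both the truth and the failure of each atomic statement.
  let s : Set (Set (L.Structure ℕ)) := Set.range
    fun i : Σ n, (L.Relations n × (Fin n → ℕ)) × Bool =>
      {M | M.RelMap i.2.1.1 i.2.1.2 ↔ i.2.2 = true}
  -- Only this inequality is needed, since a finer topology has more Borel sets.
  have hle : TopologicalSpace.generateFrom s ≤ structureTopology L := by
    refine le_inf (le_iInf fun n => le_iInf fun F => isEmptyElim F)
      (le_iInf fun n => le_iInf fun R => le_iInf fun v => ?_)
    rintro _ ⟨V, -, rfl⟩
    let _ : TopologicalSpace (L.Structure ℕ) := TopologicalSpace.generateFrom s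
    have h : (fun M : L.Structure ℕ => M.RelMap R v) ⁻¹' V =
        ⋃ b : Bool, ⋃ _ : (b = true) ∈ V, {M | M.RelMap R v ↔ b = true} := by
      ext M
      by_cases hM : M.RelMap R v <;> simp [hM]
    change IsOpen ((fun M : L.Structure ℕ => M.RelMap R v) ⁻¹' V)
    rw [h]
    exact isOpen_iUnion fun b => isOpen_iUnion fun _ =>
      TopologicalSpace.isOpen_generateFrom_of_mem ⟨⟨n, (R, v), b⟩, rfl⟩
  have hs : s.Countable := Set.countable_range _
  have hborel : @borel (L.Structure ℕ) (structureTopology L) ≤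
      MeasurableSpace.generateFrom s := by
    refine (borel_anti hle).trans (le_of_eq ?_)
    let _ : TopologicalSpace (L.Structure ℕ) := TopologicalSpace.generateFrom s
    have : SecondCountableTopology (L.Structure ℕ) := ⟨s, hs, rfl⟩
    exact borel_eq_generateFrom_of_subbasis rfl
  have hmod : modMeasurableSpace Ψ =
      (@borel (L.Structure ℕ) (structureTopology L)).comap Subtype.val :=
    (@borel_comap _ _ Subtype.val (structureTopology L))
  rw [hmod, measurable_comap_iff]
  refine Measurable.mono (mb := MeasurableSpace.generateFrom s) ?_ le_rfl hborel
  refine measurable_generateFrom ?_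
  rintro _ ⟨⟨n, ⟨R, v⟩, b⟩, rfl⟩
  exact measurableSet_setOfPred.2 ((hf n R v).iff measurable_const)

/-- The statement that `n` is the `i`-th element of `A ω` depends only on the trace of `A ω` on
`{0, …, n}`. -/
theorem measurable_nth {Ω : Type w} [MeasurableSpace Ω] {A : Ω → ℕ → Prop}
    (hinf : ∀ ω, (Set.ofPred (A ω)).Infinite) (hA : ∀ n, Measurable fun ω => A ω n) (i : ℕ) :
    Measurable fun ω => Nat.nth (A ω) i := by
  classical
  have hcount : ∀ n, Measurable fun ω => Nat.count (A ω) n := by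
    intro n
    induction n with
    | zero => simp
    | succ n ih =>
      simp only [Nat.count_succ]
      exact ih.add (Measurable.ite (measurableSet_setOfPred.2 (hA n)) measurable_const
        measurable_const)
  refine measurable_to_countable' fun n => ?_
  have h : (fun ω => Nat.nth (A ω) i) ⁻¹' {n} = {ω | A ω n ∧ Nat.count (A ω) n = i} := by
    ext ω
    constructor
    · rintro rfl
      exact ⟨Nat.nth_mem_of_infinite (hinf ω) i, Nat.count_nth_of_infinite (hinf ω) i⟩
    · rintro ⟨h, rfl⟩
      exact Nat.nth_count h
  rw [h]
  exact measurableSet_setOfPred.2 ((hA n).and ((hcount n).eq_const i))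

theorem measurable_leastRep {Ω : Type w} [MeasurableSpace Ω] {ι : Type u} [Countable ι]
    {X : Type v} [MeasurableSpace X] (e : ℕ ≃ X) {E : Ω → ι → X → X → Prop}
    (hE : ∀ p x y, Measurable fun ω => E ω p x y)
    (hinf : ∀ ω, (Set.ofPred (IsLeastRep e (E ω))).Infinite) (i : ℕ) :
    Measurable fun ω => leastRep e (E ω) i := by
  refine (measurable_from_nat (f := e)).comp (measurable_nth hinf (fun n => ?_) i)
  exact Measurable.forall fun k => Measurable.forall fun _ =>
    (Measurable.forall fun p => hE p _ _).not

/-- Evaluation of a measurable family of predicates on a countable set at a measurable point. -/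
theorem measurable_apply {Ω : Type w} [MeasurableSpace Ω] {X : Type v} [Countable X]
    [MeasurableSpace X] [MeasurableSingletonClass X] {A : Ω → X → Prop}
    (hA : ∀ x, Measurable fun ω => A ω x) {f : Ω → X} (hf : Measurable f) :
    Measurable fun ω => A ω (f ω) := by
  have h : (fun ω => A ω (f ω)) = fun ω => ∀ x, f ω = x → A ω x := by
    ext ω
    simp
  rw [h]
  exact Measurable.forall fun x => (hf.eq_const x).imp (hA x)

end Borel

namespace SplittingPoset

variable (P : SplittingPoset.{u})

/-- The structure with given relations `E_p` and given color predicates. -/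
@[reducible]
def systemStructure (E : P.carrier → ℕ → ℕ → Prop) (C : ℕ → ℕ → Prop) :
    (P.language.sum colorLanguage).Structure ℕ where
  funMap := fun f _ => f.elim Empty.elim Empty.elim
  RelMap := fun {n} R v => match n, R, v with
    | _, Sum.inl (Rel.E p), v => E p (v 0) (v 1)
    | _, Sum.inr (ColorRel.color k), v => C k (v 0)

instance isEmpty_functions (n : ℕ) :
    IsEmpty ((P.language.sum colorLanguage).Functions n) :=
  ⟨fun f => f.elim Empty.elim Empty.elim⟩

theorem forall_relations {n : ℕ}
    {p : ∀ {n}, (P.language.sum colorLanguage).Relations n → Prop}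
    (hE : ∀ q, p (n := 2) (Sum.inl (P.symb q))) (hC : ∀ k, p (n := 1) (Sum.inr (.color k)))
    (R : (P.language.sum colorLanguage).Relations n) : p R := by
  rcases R with R | R
  · cases R
    exact hE _
  · cases R
    exact hC _

instance countable_relations (n : ℕ) :
    Countable ((P.language.sum colorLanguage).Relations n) := by
  let f : P.carrier ⊕ ℕ → Σ n, (P.language.sum colorLanguage).Relations n :=
    Sum.elim (fun q => ⟨2, Sum.inl (P.symb q)⟩) fun k => ⟨1, Sum.inr (.color k)⟩
  have hf : Function.Surjective f := by
    rintro ⟨n, R⟩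
    exact P.forall_relations (p := fun {n} R => ∃ a, f a = ⟨n, R⟩)
      (fun q => ⟨Sum.inl q, rfl⟩) (fun k => ⟨Sum.inr k, rfl⟩) R
  have := hf.countable
  exact (sigma_mk_injective (β := (P.language.sum colorLanguage).Relations) (i := n)).countable

theorem iso_iff (M N : (P.language.sum colorLanguage).Structure ℕ) :
    Iso M N ↔ SystemIso (P.eqRel M) (P.colorRel M) (P.eqRel N) (P.colorRel N) := by
  have h1 : ∀ (f : ℕ → ℕ) (v : Fin 1 → ℕ), f ∘ v = ![f (v 0)] ∧ v = ![v 0] := fun f v =>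
    ⟨by ext i; fin_cases i; rfl, by ext i; fin_cases i; rfl⟩
  have h2 : ∀ (f : ℕ → ℕ) (v : Fin 2 → ℕ), f ∘ v = ![f (v 0), f (v 1)] ∧ v = ![v 0, v 1] :=
    fun f v => ⟨by ext i; fin_cases i <;> rfl, by ext i; fin_cases i <;> rfl⟩
  constructor
  · rintro ⟨σ⟩
    refine ⟨@FirstOrder.Language.Equiv.toEquiv _ _ _ M N σ, fun p x y => ?_, fun k x => ?_⟩
    · have := @FirstOrder.Language.Equiv.map_rel' _ _ _ M N σ 2 (Sum.inl (P.symb p)) ![x, y]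
      rw [(h2 _ _).1] at this
      exact this.symm
    · have := @FirstOrder.Language.Equiv.map_rel' _ _ _ M N σ 1 (Sum.inr (ColorRel.color k)) ![x]
      rw [(h1 _ _).1] at this
      exact this.symm
  · rintro ⟨σ, hE, hC⟩
    refine ⟨@FirstOrder.Language.Equiv.mk _ _ _ M N σ (fun {n} f => isEmptyElim f) ?_⟩
    intro n R v
    revert v
    refine P.forall_relations (p := fun {n} R => ∀ v, N.RelMap R (σ ∘ v) ↔ M.RelMap R v)
      (fun q v => ?_) (fun k v => ?_) R
    · rw [(h2 σ v).1, (h2 σ v).2]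
      exact (hE q _ _).symm
    · rw [(h1 σ v).1, (h1 σ v).2]
      exact (hC k _).symm

theorem model_iff {M : (P.language.sum colorLanguage).Structure ℕ} {a : Empty → ℕ}
    {xs : Fin 0 → ℕ} : @InfFormula.Realize _ Empty ℕ M 0 (colorings P.Φ) a xs ↔
      IsSplittingSystem P.δ (P.eqRel M) ∧ Separates (P.eqRel M) ∧
        IsColoring (P.colorRel M) := by
  rw [Subsingleton.elim a (@default _ Unique.instInhabited),
    Subsingleton.elim xs (@default _ Unique.instInhabited)]
  exact P.realize_colorings M

/-- Colored models of `Φ_Q`, for `Q` a suborder of `P`, are coded by colored models of `Φ_P`: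
follow the given model at the indices in `Q`, do nothing at the other indices, and add countably
many spoiled elements of color `0`. -/
theorem Embeds.borelReducible {Q : SplittingPoset.{v}} {P : SplittingPoset.{u}}
    (h : Q.Embeds P) : BorelReducible (colorings Q.Φ) (colorings P.Φ) := by
  obtain ⟨φ, hφ, hδ⟩ := h
  have hinj : Function.Injective φ := fun a b hab =>
    le_antisymm ((hφ _ _).1 hab.le) ((hφ _ _).1 hab.ge)
  let b : P.carrier → ℕ := reindexSplit φ Q.δ
  have hb : ∀ p, 0 < b p ∧ b p ≤ P.δ p := by
    intro p
    by_cases hp : ∃ q, φ q = p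
    · obtain ⟨q, rfl⟩ := hp
      simp only [b, reindexSplit_apply hinj]
      exact ⟨zero_lt_two.trans_le (Q.two_le_δ q), hδ q⟩
    · simp only [b, reindexSplit_of_notMem hp]
      exact ⟨zero_lt_one, one_le_two.trans (P.two_le_δ p)⟩
  have hd : ∀ p, 0 < P.δ p := fun p => zero_lt_two.trans_le (P.two_le_δ p)
  have : Nonempty (ℕ ≃ ℕ × Defect P.δ) := by
    have : Nonempty (Defect P.δ) := ⟨Defect.zero hd⟩
    exact nonempty_equiv_of_countable
  obtain ⟨e⟩ := this
  let _ : MeasurableSpace (ℕ × Defect P.δ) := ⊤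
  have hQ : ∀ M : Mod (colorings Q.Φ), IsSplittingSystem Q.δ (Q.eqRel M.1) ∧
      Separates (Q.eqRel M.1) ∧ IsColoring (Q.colorRel M.1) := fun M => Q.model_iff.1 M.2
  let E₀ : Mod (colorings Q.Φ) → P.carrier → ℕ → ℕ → Prop := fun M => reindexRel φ (Q.eqRel M.1)
  let E : Mod (colorings Q.Φ) → P.carrier → ℕ × Defect P.δ → ℕ × Defect P.δ → Prop :=
    fun M => enlargeRel b (E₀ M)
  let C : Mod (colorings Q.Φ) → ℕ → ℕ × Defect P.δ → Prop :=
    fun M => enlargeColor b (Q.colorRel M.1)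
  have hE₀ : ∀ M, IsSplittingSystem b (E₀ M) := fun M => (hQ M).1.reindex hφ
  have hsep : ∀ M, Separates (E₀ M) := fun M => (hQ M).2.1.reindex
  have hE : ∀ M, IsSplittingSystem P.δ (E M) := fun M =>
    (hE₀ M).enlarge (fun p => (hb p).1) fun p => (hb p).2
  have hzero : ∀ M, Separates fun p m n => E M p (m, Defect.zero hd) (n, Defect.zero hd) :=
    fun M m n hmn => hsep M m n fun p =>
      ((hE₀ M).enlargeRel_zero_iff (fun p => (hb p).1) hd).1 (hmn p)
  let ν : Mod (colorings Q.Φ) → ℕ → ℕ × Defect P.δ := fun M => leastRep e (E M)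
  have hν : ∀ M, IsTransversal (E M) (ν M) := fun M =>
    isTransversal_leastRep e (hE M).equiv (hzero M)
  -- The structure with universe `ℕ` obtained by keeping the least representatives.
  have hmodel : ∀ M, @InfFormula.Realize _ Empty ℕ
      (P.systemStructure (fun p i j => E M p (ν M i) (ν M j)) fun k i => C M k (ν M i))
      0 (colorings P.Φ) default default := fun M =>
    P.model_iff.2 ⟨(hE M).comap (hν M), (hν M).separates, fun i => (hQ M).2.2.enlarge (ν M i)⟩
  refine ⟨fun M => ⟨_, hmodel M⟩, measurable_mod ?_, fun M N => ?_⟩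
  · have hmE : ∀ p x y, Measurable fun M => E M p x y := fun p x y =>
      Measurable.forall fun r => Measurable.forall fun _ => measurable_const.and <|
        measurable_const.and <| Measurable.imp measurable_const <|
          Measurable.forall fun q => Measurable.forall fun _ => measurable_relMap _ _
    have hmC : ∀ k x, Measurable fun M => C M k x := fun k x =>
      measurable_const.or <| measurable_const.and <| Measurable.exists fun l =>
        measurable_const.and <| measurable_relMap _ _
    have hmν : ∀ i, Measurable fun M => ν M i := measurable_leastRep e hmE fun M =>
      infinite_isLeastRep e (hE M).equiv (hzero M)
    intro n R
    refine P.forall_relations (p := fun {n} R => ∀ v : Fin n → ℕ, Measurable fun M =>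
      (P.systemStructure (fun p i j => E M p (ν M i) (ν M j)) fun k i => C M k (ν M i)).RelMap
        R v) (fun p v => ?_) (fun k v => ?_) R
    · exact measurable_apply (A := fun M x => E M p x (ν M (v 1)))
        (fun x => measurable_apply (hmE p x) (hmν (v 1))) (hmν (v 0))
    · exact measurable_apply (hmC k) (hmν (v 0))
  · rw [Q.iso_iff, P.iso_iff, ← systemIso_reindex_iff hφ (hQ M).1 (hQ N).1]
    constructor
    · intro hMN
      have h := SystemIso.comap (hE N).equiv (hν M) (hν N)
        (fun x y hxy => enlargeColor_congr (hsep N) hxy) (hMN.enlarge b P.δ)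
      exact h
    -- The elements without color `0` form a copy of the given model.
    · intro hMN
      have hgood : ∀ M, SystemIso (Y := {i // ¬ C M 0 (ν M i)}) (E₀ M) (Q.colorRel M.1)
          (fun p i j => E M p (ν M i) (ν M j)) fun k i => C M (k + 1) (ν M i) := fun M =>
        systemIso_restrict_enlarge (hE₀ M) (hsep M) (fun p => (hb p).1) hd (hν M)
      exact ((hgood M).trans hMN.restrict).trans (hgood N).symm

end SplittingPoset

end BorelComplexity

theorem mainTheorem6 (P : BorelComplexity.SplittingPoset.{u})
    (hP : ¬ P.NearlyBinaryCrosscutting) :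
    ∃ i : Fin 4, BorelComplexity.BorelReducible
      (BorelComplexity.colorings (BorelComplexity.benchmark i).Φ)
      (BorelComplexity.colorings P.Φ) :=
  (BorelComplexity.SplittingPoset.exists_benchmark_embeds hP).imp fun _ h => h.borelReducible
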